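/- Write $G\to F$ if every colouring of the edges of the graph $G$ with two colours yields a monochromatic copy of $F$. Let $P_n$ be the path on $n$ vertices, and let $\hat R(F)=\min\{|E(G)| : G\to F\}$ be the size-Ramsey number of $F$, the minimum being over finite simple graphs $G$. For $d\ge 1$ and $m$ with $dm$ even, let $\mathcal G_{m,d}$ be a uniformly random $d$-regular simple graph on the vertex set $\{1,\dots,m\}$. Let $c=5.4806$ and $d=27$. Then: 1. For every sequence $(N_n)_{n\ge 0}$ of even non-negative integers with $|N_n-cn|<2$ for all $n$ (that is, $cn$ rounded up or down to an even integer), $$\lim_{n\to\infty}\mathbb P\bigl(\mathcal G_{N_n,d}\to P_n\bigr)=1 .$$ 2. Consequently, $\hat R(P_n)<74n$ for all sufficiently large $n$. -/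

import Mathlib

open Filter Topology MeasureTheory ProbabilityTheory

/-- `G → (F)_r`: every colouring of the edges of `G` with `r` colours yields a
monochromatic copy of `F`. -/
def Arrows {V W : Type*} (G : SimpleGraph V) (F : SimpleGraph W) (r : ℕ) : Prop :=
  ∀ C : G.EdgeLabeling (Fin r), ∃ k : Fin r, F.IsContained (C.labelGraph k)

/-- The `r`-colour size-Ramsey number of `F`: the least number of edges of a finite graph `G`
with `G → (F)_r`. It is valued in `ℕ∞`, so that it would be `⊤` if there were no such `G`. -/
noncomputable def sizeRamsey {W : Type*} (F : SimpleGraph W) (r : ℕ) : ℕ∞ :=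
  ⨅ (m : ℕ) (G : SimpleGraph (Fin m)) (_ : Arrows G F r), G.edgeSet.encard

open Classical in
/-- The set of all `d`-regular simple graphs on `m` labelled vertices. -/
def regularGraphs (m d : ℕ) : Set (SimpleGraph (Fin m)) :=
  {G | G.IsRegularOfDegree d}

/-- The random `d`-regular graph on `m` labelled vertices: the uniform probability distribution
on `d`-regular simple graphs (it is the zero measure if there are none, for instance if `m * d`
is odd). -/
noncomputable def randomRegularGraph (m d : ℕ) : Measure (SimpleGraph (Fin m)) :=
  uniformOn (regularGraphs m d)

/-! ### Depth-first search, and the structure forced by a colouring without a monochromatic path. -/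

section PathSplit

variable {V : Type*}

/-! Suppose a 2-colouring of a graph on `N` vertices has no monochromatic `P_n`. Depth-first search
in colour 0, stopped when the finished set `D` and the unvisited set `U` have equal size, leaves out
only a path on fewer than `n` vertices, and no edge of colour 0 joins `D` to `U`. A second search on
`D ∪ U`, in the bipartite graph of colour-1 edges between `D` and `U`, gives `D'`, `U'` in the same
way. Its leftover path alternates between `D` and `U`. Counting then gives two pairs of equal-sized
sets, `D' ∩ D` with `U' ∩ U` and `D' ∩ U` with `U' ∩ D`, with no edge of either colour inside a
pair. After trimming, all but exactly `2n` vertices lie in these four sets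
(`exists_typing_of_not_arrows`).

It remains to show by a first-moment argument that a random regular graph rarely has this structure.
In the pairing model, the pairings that respect a given typing are counted by a generating function
with a free weight `u` (`card_equiv_typing_mul_le`). Typings are counted by a multinomial bound,
worst when the two pairs are balanced (`card_typings_mul_le`). Each regular graph comes from the
same number of pairings, and a switching argument shows that at least an inverse-polynomial
proportion of pairings is simple (`card_equiv_le_mul_card_simple`), so passing to simple graphs
costs only a polynomial factor. The proportion of bad graphs is therefore at most a polynomial times
`exp (N * firstMomentRate d u ρ)`, where `ρ = 2n/N`. For `d = 27` and `c = 5.4806` the rate at the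
limiting `ρ` is just below zero (`firstMomentRate_neg`).

The size-Ramsey bound follows because such a graph has about `27cn/2 = 73.9881n` edges. -/

theorem SimpleGraph.pathGraph_isContained_of_isChain {H : SimpleGraph V} {l : List V} {n : ℕ}
    (hd : l.Nodup) (hc : l.IsChain H.Adj) (hn : n ≤ l.length) :
    (SimpleGraph.pathGraph n).IsContained H := by
  refine ⟨⟨⟨fun i => l.get ⟨i, i.2.trans_le hn⟩, ?_⟩, ?_⟩⟩
  · intro a b hab
    rw [List.isChain_iff_getElem] at hc
    rcases SimpleGraph.pathGraph_adj.1 hab with h | h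
    · have := hc a.1 (by have := b.2; omega)
      simpa [h] using this
    · have := hc b.1 (by have := a.2; omega)
      simpa [h] using this.symm
  · intro a b hab
    have := (List.Nodup.get_inj_iff hd).1 hab
    simpa [Fin.ext_iff] using this

/-- The state of a depth-first search on `H` inside `W`: `D` is the set of finished vertices,
`U` the set of unvisited ones, and `l` the current path. -/
structure SimpleGraph.SearchState [DecidableEq V] (H : SimpleGraph V) (W D U : Finset V)
    (l : List V) : Prop where
  nodup : l.Nodup
  chain : l.IsChain H.Adj
  disj : Disjoint D U
  disjD : Disjoint D l.toFinset
  disjU : Disjoint U l.toFinset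
  union : D ∪ U ∪ l.toFinset = W
  noAdj : ∀ a ∈ D, ∀ b ∈ U, ¬H.Adj a b

/-- Each search step either moves an unvisited vertex onto the path or retires the active end of the
path. Both lower `|U| - |D|` by exactly one, so the difference takes every value from `|W|` down to
`0`. The induction is on the number `k` of steps, and the head of `l` is the active end. -/
theorem SimpleGraph.exists_searchState [DecidableEq V] (H : SimpleGraph V) (W : Finset V)
    (j k : ℕ) (hjk : j + k = W.card) :
    ∃ D U l, H.SearchState W D U l ∧ D.card + j = U.card := by
  induction k generalizing j with
  | zero => exact ⟨∅, W, [], ⟨by simp, by simp, by simp, by simp, by simp, by simp, by simp⟩,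
      by simpa using hjk⟩
  | succ k ih =>
    obtain ⟨D, U, l, h, hc⟩ := ih (j + 1) (by omega)
    obtain ⟨h1, h2, h3, h4, h5, h6, h7⟩ := h
    have push : ∀ u ∈ U, (u :: l).IsChain H.Adj →
        ∃ D U l, H.SearchState W D U l ∧ D.card + j = U.card := by
      intro u hu hch
      refine ⟨D, U.erase u, u :: l, ⟨?_, hch, ?_, ?_, ?_, ?_, ?_⟩, ?_⟩
      · have : u ∉ l := fun h => Finset.disjoint_left.1 h5 hu (by simpa using h)
        simp [this, h1]
      · exact h3.mono_right (Finset.erase_subset _ _)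
      · rw [Finset.disjoint_left] at *
        intro a ha
        have := h3 ha
        have := h4 ha
        simp at *
        refine ⟨?_, this⟩
        rintro rfl
        contradiction
      · rw [Finset.disjoint_left] at *
        intro a ha
        have := h5 (Finset.mem_of_mem_erase ha)
        simp at *
        exact ⟨ha.1, this⟩
      · rw [← h6]
        ext a
        simp only [Finset.mem_union, Finset.mem_erase, List.toFinset_cons, Finset.mem_insert]
        by_cases hau : a = u
        · subst hau; simp [hu]
        · simp [hau]
      · exact fun a ha b hb => h7 a ha b (Finset.mem_of_mem_erase hb)
      · rw [Finset.card_erase_of_mem hu]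
        omega
    match l, h1, h2, h4, h5, h6, push with
    | [], h1, h2, h4, h5, h6, push =>
      obtain ⟨u, hu⟩ : U.Nonempty := Finset.card_pos.1 (by omega)
      exact push u hu (by simp)
    | v :: l, h1, h2, h4, h5, h6, push =>
      by_cases hv : ∃ u ∈ U, H.Adj u v
      · obtain ⟨u, hu, huv⟩ := hv
        exact push u hu (by simp [huv, h2])
      · push Not at hv
        have hvD : v ∉ D := fun h => Finset.disjoint_left.1 h4 h (by simp)
        have hvU : v ∉ U := fun h => Finset.disjoint_left.1 h5 h (by simp)
        refine ⟨insert v D, U, l, ⟨(List.nodup_cons.1 h1).2, h2.tail, ?_, ?_, ?_, ?_, ?_⟩, ?_⟩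
        · rw [Finset.disjoint_insert_left]
          exact ⟨hvU, h3⟩
        · rw [Finset.disjoint_insert_left]
          refine ⟨by simpa using (List.nodup_cons.1 h1).1, h4.mono_right ?_⟩
          simp
        · refine h5.mono_right ?_
          simp
        · rw [← h6]
          ext a
          simp only [Finset.mem_union, Finset.mem_insert, List.toFinset_cons]
          tauto
        · intro a ha b hb
          rcases Finset.mem_insert.1 ha with rfl | ha
          · exact fun hab => hv b hb hab.symm
          · exact h7 a ha b hb
        · rw [Finset.card_insert_of_notMem hvD]
          omega

theorem SimpleGraph.exists_split [DecidableEq V] (H : SimpleGraph V) (W : Finset V) :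
    ∃ D U l, H.SearchState W D U l ∧ D.card = U.card := by
  simpa using H.exists_searchState W 0 W.card (by simp)

/-- The path alternates between `S` and `T`, so its vertices can be removed in consecutive pairs,
one from each side. -/
theorem SimpleGraph.countP_mem_eq_of_isChain [DecidableEq V] {H : SimpleGraph V} {S T : Finset V}
    (hST : Disjoint S T) (hH : ∀ a b, H.Adj a b → a ∈ S ∧ b ∈ T ∨ a ∈ T ∧ b ∈ S) :
    ∀ (l : List V), l.IsChain H.Adj → Even l.length →
      l.countP (· ∈ S) = l.countP (· ∈ T)
  | [], _, _ => by simp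
  | [a], _, h => by simp at h
  | a :: b :: l, hc, he => by
    have ih := SimpleGraph.countP_mem_eq_of_isChain hST hH l hc.tail.tail
      (by simpa [Nat.even_add_one] using he)
    have hab : H.Adj a b := by simp at hc; exact hc.1
    rw [Finset.disjoint_left] at hST
    rcases hH a b hab with ⟨h1, h2⟩ | ⟨h1, h2⟩
    · have h3 := hST h1
      have h4 : b ∉ S := fun h => hST h h2
      simp [h1, h2, h3, h4, ih]
    · have h3 := hST h2
      have h4 : a ∉ S := fun h => hST h h1
      simp [h1, h2, h3, h4, ih]


/-- The pairs of vertex types between which there must be no edge. -/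
def ForbiddenTypes (i j : Fin 5) : Prop :=
  (i = 0 ∧ j = 1) ∨ (i = 1 ∧ j = 0) ∨ (i = 2 ∧ j = 3) ∨ (i = 3 ∧ j = 2)

instance : DecidableRel ForbiddenTypes := fun i j => by unfold ForbiddenTypes; infer_instance

/-- `t` is a partition of the vertices into two pairs of sets of size `x` and `y`, respectively,
and a set of `r` further vertices. -/
def HasTypeSizes [Fintype V] (t : V → Fin 5) (x y r : ℕ) : Prop :=
  ∀ i, (Finset.univ.filter fun v => t v = i).card = ![x, x, y, y, r] i

theorem exists_typing_of_finsets [Fintype V] [DecidableEq V] (G : SimpleGraph V)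
    {A₁ A₂ B₁ B₂ : Finset V} {x y r : ℕ} (hA₁ : A₁.card = x) (hA₂ : A₂.card = x)
    (hB₁ : B₁.card = y) (hB₂ : B₂.card = y) (h12 : Disjoint A₁ A₂) (h13 : Disjoint A₁ B₁)
    (h14 : Disjoint A₁ B₂) (h23 : Disjoint A₂ B₁) (h24 : Disjoint A₂ B₂) (h34 : Disjoint B₁ B₂)
    (hr : 2 * (x + y) + r = Fintype.card V) (hA : ∀ a ∈ A₁, ∀ b ∈ A₂, ¬G.Adj a b)
    (hB : ∀ a ∈ B₁, ∀ b ∈ B₂, ¬G.Adj a b) :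
    ∃ t : V → Fin 5, HasTypeSizes t x y r ∧ ∀ u v, G.Adj u v → ¬ForbiddenTypes (t u) (t v) := by
  rw [Finset.disjoint_left] at *
  let t : V → Fin 5 := fun v =>
    if v ∈ A₁ then 0 else if v ∈ A₂ then 1 else if v ∈ B₁ then 2 else if v ∈ B₂ then 3 else 4
  have t0 : ∀ v, t v = 0 ↔ v ∈ A₁ := by intro v; simp only [t]; split_ifs <;> simp_all
  have t1 : ∀ v, t v = 1 ↔ v ∈ A₂ := by intro v; simp only [t]; split_ifs <;> simp_all
  have t2 : ∀ v, t v = 2 ↔ v ∈ B₁ := by intro v; simp only [t]; split_ifs <;> simp_all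
  have t3 : ∀ v, t v = 3 ↔ v ∈ B₂ := by intro v; simp only [t]; split_ifs <;> simp_all
  have c0 : (Finset.univ.filter fun v => t v = 0).card = x := by
    rw [← hA₁]; congr 1; ext v; simp [t0]
  have c1 : (Finset.univ.filter fun v => t v = 1).card = x := by
    rw [← hA₂]; congr 1; ext v; simp [t1]
  have c2 : (Finset.univ.filter fun v => t v = 2).card = y := by
    rw [← hB₁]; congr 1; ext v; simp [t2]
  have c3 : (Finset.univ.filter fun v => t v = 3).card = y := by
    rw [← hB₂]; congr 1; ext v; simp [t3]
  have hsum := Finset.card_eq_sum_card_fiberwise (s := Finset.univ) (t := Finset.univ) (f := t)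
    (fun _ _ => Finset.mem_coe.2 (Finset.mem_univ _))
  rw [Fin.sum_univ_five, c0, c1, c2, c3, Finset.card_univ] at hsum
  refine ⟨t, ?_, ?_⟩
  · intro i
    fin_cases i
    · exact c0
    · exact c1
    · exact c2
    · exact c3
    · simp only [Fin.reduceFinMk, Matrix.cons_val]
      omega
  · rintro u v huv (⟨h, h'⟩ | ⟨h, h'⟩ | ⟨h, h'⟩ | ⟨h, h'⟩) <;>
      simp only [t0, t1, t2, t3] at h h'
    · exact hA u h v h' huv
    · exact hA v h' u h huv.symm
    · exact hB u h v h' huv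
    · exact hB v h' u h huv.symm

/-- Two nested searches, one per colour. Vertices separated by both splits cannot be adjacent, since
the first split excludes colour 0 and the second excludes colour 1. -/
theorem exists_typing_of_not_arrows [Fintype V] {n : ℕ} (G : SimpleGraph V)
    (hN : Even (Fintype.card V)) (h2n : 2 * n ≤ Fintype.card V)
    (hG : ¬Arrows G (SimpleGraph.pathGraph n) 2) :
    ∃ x y, 2 * (x + y) + 2 * n = Fintype.card V ∧ ∃ t : V → Fin 5, HasTypeSizes t x y (2 * n) ∧
      ∀ u v, G.Adj u v → ¬ForbiddenTypes (t u) (t v) := by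
  classical
  simp only [Arrows, not_forall, not_exists] at hG
  obtain ⟨C, hC⟩ := hG
  obtain ⟨D, U, l, h, hcard⟩ := (C.labelGraph 0).exists_split Finset.univ
  let H : SimpleGraph V :=
    { Adj := fun a b => (C.labelGraph 1).Adj a b ∧ (a ∈ D ∧ b ∈ U ∨ a ∈ U ∧ b ∈ D)
      symm := ⟨fun a b hab => ⟨hab.1.symm, by tauto⟩⟩
      loopless := ⟨fun a ha => ha.1.ne rfl⟩ }
  obtain ⟨D', U', l', h', hcard'⟩ := H.exists_split (D ∪ U)
  have hl : l.length < n := by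
    by_contra! hn
    exact hC 0 (SimpleGraph.pathGraph_isContained_of_isChain h.nodup h.chain hn)
  have hl' : l'.length < n := by
    by_contra! hn
    exact hC 1 (SimpleGraph.pathGraph_isContained_of_isChain h'.nodup
      (h'.chain.imp fun a b hab => hab.1) hn)
  have hsplit : ∀ a b, (a ∈ D ∧ b ∈ U ∨ a ∈ U ∧ b ∈ D) → a ∈ D' → b ∈ U' → ¬G.Adj a b := by
    intro a b hab ha hb hadj
    have hcol : (C.labelGraph 0).Adj a b ∨ (C.labelGraph 1).Adj a b := by
      rw [SimpleGraph.EdgeLabeling.labelGraph_adj, SimpleGraph.EdgeLabeling.labelGraph_adj]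
      rcases Fin.exists_fin_two.1 ⟨C ⟨s(a, b), hadj⟩, rfl⟩ with h0 | h1
      · exact Or.inl ⟨hadj, h0⟩
      · exact Or.inr ⟨hadj, h1⟩
    rcases hcol with h0 | h1
    · rcases hab with ⟨haD, hbU⟩ | ⟨haU, hbD⟩
      · exact h.noAdj a haD b hbU h0
      · exact h.noAdj b hbD a haU h0.symm
    · exact h'.noAdj a ha b hb ⟨h1, hab⟩
  have hcW : ∀ {D U : Finset V} {l : List V} {W : Finset V} {H : SimpleGraph V},
      H.SearchState W D U l → D.card + U.card + l.length = W.card := by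
    intro D U l W H h
    rw [← h.union, Finset.card_union_of_disjoint, Finset.card_union_of_disjoint h.disj,
      List.toFinset_card_of_nodup h.nodup]
    exact Finset.disjoint_union_left.2 ⟨h.disjD, h.disjU⟩
  have e1 := hcW h
  have e2 := hcW h'
  rw [Finset.card_univ] at e1
  rw [Finset.card_union_of_disjoint h.disj] at e2
  -- The equalities `|D| = |U|` and `|D'| = |U'|` make the length of `l'` equal to `2(|D| - |D'|)`.
  -- Hence `l'` meets `D` and `U` equally often, which forces `|D' ∩ D| = |U' ∩ U|` and `|D' ∩ U| =
  -- |U' ∩ D|`.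
  have hev : Even l'.length := ⟨D.card - D'.card, by omega⟩
  have hcount := SimpleGraph.countP_mem_eq_of_isChain (H := H) h.disj
    (fun a b hab => hab.2) l' h'.chain hev
  have part : ∀ S : Finset V, S ⊆ D ∪ U →
      (D' ∩ S).card + (U' ∩ S).card + l'.countP (· ∈ S) = S.card := by
    intro S hS
    have hl : l'.countP (· ∈ S) = (l'.toFinset ∩ S).card := by
      rw [List.countP_eq_length_filter, ← List.toFinset_card_of_nodup (h'.nodup.filter _)]
      congr 1
      ext a
      simp
    rw [hl, ← Finset.card_union_of_disjoint, ← Finset.card_union_of_disjoint]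
    · congr 1
      rw [← Finset.union_inter_distrib_right, ← Finset.union_inter_distrib_right, h'.union]
      exact Finset.inter_eq_right.2 hS
    · rw [← Finset.union_inter_distrib_right]
      exact (Finset.disjoint_union_left.2 ⟨h'.disjD, h'.disjU⟩).mono
        Finset.inter_subset_left Finset.inter_subset_left
    · exact h'.disj.mono Finset.inter_subset_left Finset.inter_subset_left
  have p1 := part D Finset.subset_union_left
  have p2 := part U Finset.subset_union_right
  have two : ∀ S : Finset V, S ⊆ D ∪ U → (S ∩ D).card + (S ∩ U).card = S.card := by
    intro S hS
    rw [← Finset.card_union_of_disjoint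
      (h.disj.mono Finset.inter_subset_right Finset.inter_subset_right),
      ← Finset.inter_union_distrib_left, Finset.inter_eq_left.2 hS]
  have hD'W : D' ⊆ D ∪ U := by
    rw [← h'.union]; exact Finset.subset_union_left.trans Finset.subset_union_left
  have hU'W : U' ⊆ D ∪ U := by
    rw [← h'.union]; exact Finset.subset_union_right.trans Finset.subset_union_left
  have q1 := two D' hD'W
  have q2 := two U' hU'W
  obtain ⟨k, hk⟩ := hN
  -- With `N = 2k`, both paths being shorter than `n` gives `|D'| ≥ k - n`. So sizes with `x + y = k
  -- - n` can be chosen, filling the first pair before the second.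
  obtain ⟨x, y, hx, hy, hxy⟩ : ∃ x y, x ≤ (D' ∩ D).card ∧ y ≤ (D' ∩ U).card ∧
      2 * (x + y) + 2 * n = Fintype.card V := by
    rcases le_total (k - n) (D' ∩ D).card with hle | hle
    · exact ⟨k - n, 0, hle, Nat.zero_le _, by omega⟩
    · exact ⟨(D' ∩ D).card, k - n - (D' ∩ D).card, le_rfl, by omega, by omega⟩
  obtain ⟨A₁, hA₁, cA₁⟩ := Finset.exists_subset_card_eq hx
  obtain ⟨A₂, hA₂, cA₂⟩ := Finset.exists_subset_card_eq (s := U' ∩ U) (n := x) (by omega)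
  obtain ⟨B₁, hB₁, cB₁⟩ := Finset.exists_subset_card_eq hy
  obtain ⟨B₂, hB₂, cB₂⟩ := Finset.exists_subset_card_eq (s := U' ∩ D) (n := y) (by omega)
  refine ⟨x, y, hxy, exists_typing_of_finsets G cA₁ cA₂ cB₁ cB₂ ?_ ?_ ?_ ?_ ?_ ?_ hxy ?_ ?_⟩
  · exact h.disj.mono (hA₁.trans Finset.inter_subset_right) (hA₂.trans Finset.inter_subset_right)
  · exact h.disj.mono (hA₁.trans Finset.inter_subset_right) (hB₁.trans Finset.inter_subset_right)
  · exact h'.disj.mono (hA₁.trans Finset.inter_subset_left) (hB₂.trans Finset.inter_subset_left)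
  · exact h'.disj.symm.mono (hA₂.trans Finset.inter_subset_left)
      (hB₁.trans Finset.inter_subset_left)
  · exact h.disj.symm.mono (hA₂.trans Finset.inter_subset_right)
      (hB₂.trans Finset.inter_subset_right)
  · exact h'.disj.mono (hB₁.trans Finset.inter_subset_left) (hB₂.trans Finset.inter_subset_left)
  · intro a ha b hb
    have ha := Finset.mem_inter.1 (hA₁ ha)
    have hb := Finset.mem_inter.1 (hA₂ hb)
    exact hsplit a b (Or.inl ⟨ha.2, hb.2⟩) ha.1 hb.1
  · intro a ha b hb
    have ha := Finset.mem_inter.1 (hB₁ ha)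
    have hb := Finset.mem_inter.1 (hB₂ hb)
    exact hsplit a b (Or.inr ⟨ha.2, hb.2⟩) ha.1 hb.1

end PathSplit

/-! ### Switchings that remove loops and parallel edges from a pairing. -/

section Switching

variable {E V : Type*}

/-- The edge indexed by `i` in the multigraph whose edge `i` joins `f (i, false)` to
`f (i, true)`. -/
def edgeAt (f : E × Bool → V) (i : E) : Sym2 V := s(f (i, false), f (i, true))

/-- An edge of a multigraph is defective if it is a loop or parallel to another edge. -/
def IsDefect (f : E × Bool → V) (i : E) : Prop :=
  f (i, false) = f (i, true) ∨ ∃ j, j ≠ i ∧ edgeAt f j = edgeAt f i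

open scoped Classical in
/-- The set of defective edges. -/
noncomputable def defects [Fintype E] (f : E × Bool → V) : Finset E :=
  Finset.univ.filter (IsDefect f)

/-- Take a defective edge `ab` and a sound edge `ce` that avoids `a`, `b` and all their neighbours.
Replacing the two by `ae` and `cb` repairs the defect, and neither new edge is a loop or parallel to
another edge. The size hypothesis guarantees that such a `ce` exists. -/
theorem exists_swap_defects_lt [Fintype E] [DecidableEq E] {d : ℕ} (f : E × Bool → V)
    (hf : ∀ v : V, {p | f p = v}.ncard ≤ d) {i : E} (hi : i ∈ defects f)
    (hcard : (defects f).card + (2 * d + 2) * d < Fintype.card E) :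
    ∃ p q, (defects (f ∘ Equiv.swap p q)).card < (defects f).card := by
  classical
  have hf' : ∀ v : V, (Finset.univ.filter fun p => f p = v).card ≤ d := by
    intro v
    have := hf v
    rwa [Set.ncard_eq_toFinset_card', Set.toFinset_ofPred] at this
  obtain ⟨a, ha⟩ : ∃ a, f (i, false) = a := ⟨_, rfl⟩
  obtain ⟨b, hb⟩ : ∃ b, f (i, true) = b := ⟨_, rfl⟩
  let nbr : V → Finset V := fun v =>
    (Finset.univ.filter fun p => f p = v).image fun p => f (p.1, !p.2)
  have hnbr : ∀ v, (nbr v).card ≤ d := fun v => Finset.card_image_le.trans (hf' v)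
  have hedge : ∀ k v w, edgeAt f k = s(v, w) → w ∈ nbr v := by
    intro k v w hk
    simp only [nbr, Finset.mem_image, Finset.mem_filter, Finset.mem_univ, true_and]
    rcases Sym2.eq_iff.1 hk with ⟨h1, h2⟩ | ⟨h1, h2⟩
    · exact ⟨(k, false), h1, h2⟩
    · exact ⟨(k, true), h2, h1⟩
  -- The vertices that the auxiliary edge must avoid. There are at most `2d + 2` of them, so at most
  -- `(2d + 2)d` edges are excluded.
  let X : Finset V := {a, b} ∪ (nbr a ∪ nbr b)
  have hX : X.card ≤ 2 * d + 2 := by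
    have h1 : X.card ≤ _ := Finset.card_union_le _ _
    have h2 := Finset.card_union_le (nbr a) (nbr b)
    have h3 : ({a, b} : Finset V).card ≤ 2 := Finset.card_le_two
    have := hnbr a
    have := hnbr b
    omega
  let Y : Finset E := (X.biUnion fun v => Finset.univ.filter fun p => f p = v).image Prod.fst
  have hY : Y.card ≤ (2 * d + 2) * d :=
    Finset.card_image_le.trans ((Finset.card_biUnion_le_card_mul _ _ _ fun v _ => hf' v).trans
      (Nat.mul_le_mul_right _ hX))
  obtain ⟨j, hj⟩ : ∃ j, j ∉ defects f ∪ Y := by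
    by_contra! h
    have : Fintype.card E ≤ (defects f ∪ Y).card :=
      Finset.card_le_card fun x _ => h x
    have := Finset.card_union_le (defects f) Y
    omega
  rw [Finset.notMem_union] at hj
  obtain ⟨hjd, hjY⟩ := hj
  have hji : j ≠ i := fun h => hjd (h ▸ hi)
  have hjX : ∀ c, f (j, c) ∉ X := by
    intro c hc
    refine hjY (Finset.mem_image.2 ⟨(j, c), ?_, rfl⟩)
    simp [hc]
  obtain ⟨c, hc⟩ : ∃ c, f (j, false) = c := ⟨_, rfl⟩
  obtain ⟨e, he⟩ : ∃ e, f (j, true) = e := ⟨_, rfl⟩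
  have hcX : c ∉ X := hc ▸ hjX false
  have heX : e ∉ X := he ▸ hjX true
  simp only [defects, Finset.mem_filter, Finset.mem_univ, true_and, IsDefect, not_or,
    not_exists, not_and] at hjd
  have hce : c ≠ e := by rw [← hc, ← he]; exact hjd.1
  simp only [X, Finset.mem_union, Finset.mem_insert, Finset.mem_singleton, not_or] at hcX heX
  obtain ⟨⟨hca, hcb⟩, -, hcb'⟩ := hcX
  obtain ⟨⟨hea, heb⟩, hea', -⟩ := heX
  refine ⟨(i, true), (j, true), ?_⟩
  set g := f ∘ Equiv.swap (i, true) (j, true) with hg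
  have gi : edgeAt g i = s(a, e) := by
    simp [edgeAt, hg, Equiv.swap_apply_def, ha, he]
  have gj : edgeAt g j = s(c, b) := by
    simp [edgeAt, hg, Equiv.swap_apply_def, hb, hc]
  have gk : ∀ k c, k ≠ i → k ≠ j → g (k, c) = f (k, c) := by
    intro k c h1 h2
    simp [hg, Equiv.swap_apply_def, h1, h2]
  have gk' : ∀ k, k ≠ i → k ≠ j → edgeAt g k = edgeAt f k := by
    intro k h1 h2
    simp [edgeAt, gk k _ h1 h2]
  have n1 : ∀ k, edgeAt f k ≠ s(a, e) := fun k hk => hea' (hedge k _ _ hk)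
  have n2 : ∀ k, edgeAt f k ≠ s(c, b) := fun k hk => hcb' (hedge k _ _ (hk.trans Sym2.eq_swap))
  have n3 : s(a, e) ≠ s(c, b) := by
    intro h
    rcases Sym2.eq_iff.1 h with ⟨h1, h2⟩ | ⟨h1, h2⟩
    · exact hca h1.symm
    · exact hce h2.symm
  have goodi : ¬IsDefect g i := by
    rintro (h | ⟨k, hk, h⟩)
    · have : g (i, false) = a ∧ g (i, true) = e := by
        simp [hg, Equiv.swap_apply_def, ha, he]
      exact hea ((this.1.symm.trans (h.trans this.2)).symm)
    · rw [gi] at h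
      by_cases hkj : k = j
      · subst hkj; exact n3 (h.symm.trans gj)
      · exact n1 k ((gk' k hk hkj).symm.trans h)
  have goodj : ¬IsDefect g j := by
    rintro (h | ⟨k, hk, h⟩)
    · have : g (j, false) = c ∧ g (j, true) = b := by
        simp [hg, Equiv.swap_apply_def, hb, hc]
      exact hcb (this.1.symm.trans (h.trans this.2))
    · rw [gj] at h
      by_cases hki : k = i
      · subst hki; exact n3 (gi.symm.trans h)
      · exact n2 k ((gk' k hki hk).symm.trans h)
  refine (Finset.card_le_card (t := (defects f).erase i) ?_).trans_lt
    (Finset.card_erase_lt_of_mem hi)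
  intro k hk
  simp only [defects, Finset.mem_filter, Finset.mem_univ, true_and, Finset.mem_erase] at hk ⊢
  have hki : k ≠ i := by rintro rfl; exact goodi hk
  have hkj : k ≠ j := by rintro rfl; exact goodj hk
  refine ⟨hki, ?_⟩
  rcases hk with h | ⟨l, hl, h⟩
  · left
    rwa [gk k _ hki hkj, gk k _ hki hkj] at h
  · right
    rw [gk' k hki hkj] at h
    have hli : l ≠ i := by rintro rfl; exact n1 k (h.symm.trans gi)
    have hlj : l ≠ j := by rintro rfl; exact n2 k (h.symm.trans gj)
    exact ⟨l, hl, (gk' l hli hlj).symm.trans h⟩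

variable {Q : Type*} [Fintype E] [DecidableEq E] [Fintype Q] [DecidableEq Q]

open scoped Classical in
-- A pairing is recovered from its switched version once the swapped pair of half-edges is recorded.
-- This costs a factor of the square of the number of half-edges.
theorem card_defects_le_succ {d k : ℕ} (g : Q → V) (hg : ∀ v : V, {q | g q = v}.ncard ≤ d)
    (hk : k + 1 + (2 * d + 2) * d < Fintype.card E) :
    (Finset.univ.filter fun σ : E × Bool ≃ Q => (defects (g ∘ σ)).card ≤ k + 1).card ≤
      (Fintype.card (E × Bool)) ^ 2 *
        (Finset.univ.filter fun σ : E × Bool ≃ Q => (defects (g ∘ σ)).card ≤ k).card := by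
  have : Nonempty E := Fintype.card_pos_iff.1 (by omega)
  have hstep : ∀ σ : E × Bool ≃ Q, ∃ r : (E × Bool) × (E × Bool),
      (defects (g ∘ σ)).card ≤ k + 1 →
        (defects (g ∘ (Equiv.swap r.1 r.2).trans σ)).card ≤ k := by
    intro σ
    by_cases h0 : (defects (g ∘ σ)).card ≤ k
    · let p : E × Bool := (Classical.arbitrary E, true)
      exact ⟨(p, p), fun _ => by simpa using h0⟩
    · by_cases h1 : (defects (g ∘ σ)).card ≤ k + 1
      · obtain ⟨i, hi⟩ : (defects (g ∘ σ)).Nonempty := Finset.card_pos.1 (by omega)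
        obtain ⟨p, q, hpq⟩ := exists_swap_defects_lt (d := d) (g ∘ σ) (fun v => by
          refine le_trans (le_of_eq ?_) (hg v)
          exact Set.ncard_congr (fun p _ => σ p) (fun p hp => hp)
            (fun p q _ _ h => σ.injective h) (fun q hq => ⟨σ.symm q, by simpa using hq, by simp⟩))
            hi (by omega)
        refine ⟨(p, q), fun _ => ?_⟩
        have : (g ∘ (Equiv.swap p q).trans σ) = (g ∘ σ) ∘ Equiv.swap p q := rfl
        rw [this]
        omega
      · exact ⟨((Classical.arbitrary E, true), (Classical.arbitrary E, true)), fun h => absurd h h1⟩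
  choose r hr using hstep
  rw [sq, ← Fintype.card_prod, ← Finset.card_univ, ← Finset.card_product]
  refine Finset.card_le_card_of_injOn (fun σ => (r σ, (Equiv.swap (r σ).1 (r σ).2).trans σ))
    ?_ ?_
  · intro σ hσ
    have hσ : (defects (g ∘ σ)).card ≤ k + 1 := by simpa using hσ
    simpa using hr σ hσ
  · intro σ _ τ _ h
    have h1 : r σ = r τ := congrArg Prod.fst h
    have h2 : (Equiv.swap (r σ).1 (r σ).2).trans σ = (Equiv.swap (r τ).1 (r τ).2).trans τ :=
      congrArg Prod.snd h
    rw [h1] at h2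
    ext p
    have := congrArg (fun e : E × Bool ≃ Q => e (Equiv.swap (r τ).1 (r τ).2 p)) h2
    simpa using this

open scoped Classical in
theorem card_defects_le {d k : ℕ} (g : Q → V) (hg : ∀ v : V, {q | g q = v}.ncard ≤ d)
    (hk : k + (2 * d + 2) * d < Fintype.card E) :
    (Finset.univ.filter fun σ : E × Bool ≃ Q => (defects (g ∘ σ)).card ≤ k).card ≤
      (Fintype.card (E × Bool)) ^ (2 * k) *
        (Finset.univ.filter fun σ : E × Bool ≃ Q => defects (g ∘ σ) = ∅).card := by
  induction k with
  | zero => simp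
  | succ k ih =>
    refine (card_defects_le_succ g hg hk).trans ((Nat.mul_le_mul_left _ (ih (by omega))).trans ?_)
    rw [← mul_assoc, ← pow_add]
    apply le_of_eq
    congr 2
    ring

end Switching

/-! ### Averages over uniformly random bijections. -/

section Averaging

theorem card_same_value_pairs_le {Q V : Type*} [Fintype Q] {d : ℕ} (g : Q → V)
    (hg : ∀ v : V, {q | g q = v}.ncard ≤ d)
    (S : Finset (Q × Q)) (hS : ∀ q ∈ S, g q.1 = g q.2) : S.card ≤ Fintype.card Q * d := by
  classical
  have : S.card ≤ ((Finset.univ : Finset Q).sigma fun q =>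
      Finset.univ.filter fun q' => g q' = g q).card := by
    refine Finset.card_le_card_of_injOn (fun q => ⟨q.1, q.2⟩) ?_ ?_
    · intro q hq
      simp [hS q hq]
    · rintro ⟨a, b⟩ _ ⟨a', b'⟩ _ h
      simpa using h
  refine this.trans ?_
  rw [Finset.card_sigma]
  refine (Finset.sum_le_card_nsmul _ _ d fun q _ => ?_).trans (by simp)
  have := hg (g q)
  rwa [Set.ncard_eq_toFinset_card', Set.toFinset_ofPred] at this

open scoped Classical in
theorem card_embedding_two_le {Q V : Type*} [Fintype Q] {d : ℕ} (g : Q → V)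
    (hg : ∀ v : V, {q | g q = v}.ncard ≤ d) :
    (Finset.univ.filter fun e : Fin 2 ↪ Q => g (e 0) = g (e 1)).card ≤ Fintype.card Q * d := by
  let S : Finset (Q × Q) := Finset.univ.filter fun q => g q.1 = g q.2
  refine le_trans ?_ (card_same_value_pairs_le g hg S (by simp [S]))
  refine Finset.card_le_card_of_injOn (fun e => (e 0, e 1)) ?_ ?_
  · intro e he
    simpa [S] using he
  · intro e _ e' _ h
    simp only [Prod.mk.injEq] at h
    ext x
    fin_cases x
    · exact h.1
    · exact h.2

open scoped Classical in
theorem card_embedding_four_le {Q V : Type*} [Fintype Q] {d : ℕ} (g : Q → V)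
    (hg : ∀ v : V, {q | g q = v}.ncard ≤ d) :
    (Finset.univ.filter fun e : Fin 4 ↪ Q =>
      (g (e 0) = g (e 2) ∧ g (e 1) = g (e 3)) ∨ (g (e 0) = g (e 3) ∧ g (e 1) = g (e 2))).card ≤
      2 * (Fintype.card Q * d) ^ 2 := by
  let S : Finset (Q × Q) := Finset.univ.filter fun q => g q.1 = g q.2
  have hS := card_same_value_pairs_le g hg S (by simp [S])
  have hSS : (S ×ˢ S).card ≤ (Fintype.card Q * d) ^ 2 := by
    rw [Finset.card_product, sq]
    exact Nat.mul_le_mul hS hS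
  rw [Finset.filter_or, two_mul]
  refine (Finset.card_union_le _ _).trans (Nat.add_le_add ?_ ?_)
  · refine le_trans ?_ hSS
    refine Finset.card_le_card_of_injOn (fun e => ((e 0, e 2), (e 1, e 3))) ?_ ?_
    · intro e he
      simpa [S] using he
    · intro e _ e' _ h
      simp only [Prod.mk.injEq] at h
      ext x
      fin_cases x
      · exact h.1.1
      · exact h.2.1
      · exact h.1.2
      · exact h.2.2
  · refine le_trans ?_ hSS
    refine Finset.card_le_card_of_injOn (fun e => ((e 0, e 3), (e 1, e 2))) ?_ ?_
    · intro e he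
      simpa [S] using he
    · intro e _ e' _ h
      simp only [Prod.mk.injEq] at h
      ext x
      fin_cases x
      · exact h.1.1
      · exact h.2.1
      · exact h.2.2
      · exact h.1.2

variable {P Q : Type*} [Fintype P] [DecidableEq P] [Fintype Q] [DecidableEq Q]

open scoped Classical in
-- A uniform bijection restricted to `k` distinct points is a uniform injection. The symmetric group
-- is `k`-transitive, so the count does not depend on `ι`, and pairs (injection, bijection) can be
-- counted in two ways.
theorem card_equiv_restrict (k : ℕ) (R : (Fin k ↪ Q) → Prop) (ι : Fin k ↪ P) :
    Fintype.card (Fin k ↪ P) *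
        (Finset.univ.filter fun σ : P ≃ Q => R (ι.trans σ.toEmbedding)).card =
      (Finset.univ.filter R).card * Fintype.card (P ≃ Q) := by
  have hconst : ∀ ι' : Fin k ↪ P,
      (Finset.univ.filter fun σ : P ≃ Q => R (ι'.trans σ.toEmbedding)).card =
      (Finset.univ.filter fun σ : P ≃ Q => R (ι.trans σ.toEmbedding)).card := by
    intro ι'
    obtain ⟨π, hπ⟩ := (Equiv.Perm.isMultiplyPretransitive P k).exists_smul_eq ι ι'
    have hπ' : ∀ x, π (ι x) = ι' x := fun x => by rw [← hπ]; rfl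
    refine Finset.card_bij (fun σ _ => π.trans σ) ?_ ?_ ?_
    · intro σ hσ
      simp only [Finset.mem_filter, Finset.mem_univ, true_and] at hσ ⊢
      convert hσ using 1
      ext x
      simp [hπ']
    · intro σ _ τ _ h
      ext p
      have := congrArg (fun e : P ≃ Q => e (π.symm p)) h
      simpa using this
    · intro σ hσ
      refine ⟨π.symm.trans σ, ?_, ?_⟩
      · simp only [Finset.mem_filter, Finset.mem_univ, true_and] at hσ ⊢
        convert hσ using 1
        ext x
        simp [← hπ']
      · ext p; simp
  have hcount : ∀ σ : P ≃ Q,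
      (Finset.univ.filter fun ι' : Fin k ↪ P => R (ι'.trans σ.toEmbedding)).card =
      (Finset.univ.filter R).card := by
    intro σ
    refine Finset.card_bij (fun ι' _ => ι'.trans σ.toEmbedding) ?_ ?_ ?_
    · intro ι' h
      simpa using h
    · intro a _ b _ h
      ext x
      have := congrArg (fun e : Fin k ↪ Q => e x) h
      simpa using this
    · intro e he
      refine ⟨e.trans σ.symm.toEmbedding, ?_, ?_⟩
      · simp only [Finset.mem_filter, Finset.mem_univ, true_and] at he ⊢
        convert he using 1
        ext x; simp
      · ext x; simp
  have key := Finset.sum_card_bipartiteAbove_eq_sum_card_bipartiteBelow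
    (s := (Finset.univ : Finset (Fin k ↪ P))) (t := (Finset.univ : Finset (P ≃ Q)))
    (fun ι' σ => R (ι'.trans σ.toEmbedding))
  simp only [Finset.bipartiteAbove, Finset.bipartiteBelow, hconst, hcount, Finset.sum_const,
    Finset.card_univ, smul_eq_mul] at key
  rw [key, mul_comm]

end Averaging

/-! ### The expected number of defects is bounded, so many pairings are simple. -/

section Defects

variable {E Q V : Type*} [Fintype E] [DecidableEq E] [Fintype Q] [DecidableEq Q] {d : ℕ}
  (g : Q → V)

open scoped Classical in
theorem card_loop_le (hg : ∀ v : V, {q | g q = v}.ncard ≤ d)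
    (hEQ : Fintype.card (E × Bool) = Fintype.card Q) (hQ : 6 ≤ Fintype.card Q) (i : E) :
    Fintype.card E *
        (Finset.univ.filter fun σ : E × Bool ≃ Q => g (σ (i, false)) = g (σ (i, true))).card ≤
      2 * d * Fintype.card (E × Bool ≃ Q) := by
  let ι : Fin 2 ↪ E × Bool := ⟨![(i, false), (i, true)], by
    intro a b h; fin_cases a <;> fin_cases b <;> simp_all⟩
  have h := card_equiv_restrict 2 (fun e : Fin 2 ↪ Q => g (e 0) = g (e 1)) ι
  have h2 := card_embedding_two_le g hg
  have e1 : ∀ σ : E × Bool ≃ Q, (g (ι.trans σ.toEmbedding 0) = g (ι.trans σ.toEmbedding 1)) ↔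
      (g (σ (i, false)) = g (σ (i, true))) := fun σ => Iff.rfl
  simp only [e1] at h
  have hE : Fintype.card E * 2 = Fintype.card Q := by simpa using hEQ
  rw [Fintype.card_embedding_eq, hEQ, Fintype.card_fin] at h
  have hdesc : (Fintype.card Q).descFactorial 2 = 2 * Fintype.card E * (2 * Fintype.card E - 1) := by
    rw [← hE, mul_comm]; simp [Nat.descFactorial]; ring
  have hdesc' : 2 * Fintype.card E * Fintype.card E ≤ (Fintype.card Q).descFactorial 2 := by
    rw [hdesc]; exact Nat.mul_le_mul_left _ (by omega)
  set A := (Finset.univ.filter fun σ : E × Bool ≃ Q =>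
    g (σ (i, false)) = g (σ (i, true))).card
  have h3 : (2 * Fintype.card E) * (Fintype.card E * A) ≤
      (2 * Fintype.card E) * (2 * d * Fintype.card (E × Bool ≃ Q)) := by
    calc _ = 2 * Fintype.card E * Fintype.card E * A := by ring
      _ ≤ (Fintype.card Q).descFactorial 2 * A := Nat.mul_le_mul_right _ hdesc'
      _ = _ := h
      _ ≤ (Fintype.card Q * d) * Fintype.card (E × Bool ≃ Q) := Nat.mul_le_mul_right _ h2
      _ = (2 * Fintype.card E) * (d * Fintype.card (E × Bool ≃ Q)) := by rw [← hE]; ring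
      _ ≤ _ := Nat.mul_le_mul_left _ (Nat.mul_le_mul_right _ (by omega))
  exact Nat.le_of_mul_le_mul_left h3 (by omega)

open scoped Classical in
theorem card_parallel_le (hg : ∀ v : V, {q | g q = v}.ncard ≤ d)
    (hEQ : Fintype.card (E × Bool) = Fintype.card Q) (hQ : 6 ≤ Fintype.card Q) {i j : E}
    (hij : j ≠ i) :
    Fintype.card E ^ 2 *
        (Finset.univ.filter fun σ : E × Bool ≃ Q => edgeAt (g ∘ σ) j = edgeAt (g ∘ σ) i).card ≤
      8 * d ^ 2 * Fintype.card (E × Bool ≃ Q) := by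
  let ι : Fin 4 ↪ E × Bool := ⟨![(j, false), (j, true), (i, false), (i, true)], by
    intro a b h; fin_cases a <;> fin_cases b <;> simp_all⟩
  have h := card_equiv_restrict 4 (fun e : Fin 4 ↪ Q =>
    (g (e 0) = g (e 2) ∧ g (e 1) = g (e 3)) ∨ (g (e 0) = g (e 3) ∧ g (e 1) = g (e 2))) ι
  have h2 := card_embedding_four_le g hg
  have e1 : ∀ σ : E × Bool ≃ Q,
      ((g (ι.trans σ.toEmbedding 0) = g (ι.trans σ.toEmbedding 2) ∧
        g (ι.trans σ.toEmbedding 1) = g (ι.trans σ.toEmbedding 3)) ∨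
      (g (ι.trans σ.toEmbedding 0) = g (ι.trans σ.toEmbedding 3) ∧
        g (ι.trans σ.toEmbedding 1) = g (ι.trans σ.toEmbedding 2))) ↔
      edgeAt (g ∘ σ) j = edgeAt (g ∘ σ) i := fun σ => Sym2.eq_iff.symm
  simp only [e1] at h
  have hE : Fintype.card E * 2 = Fintype.card Q := by simpa using hEQ
  rw [Fintype.card_embedding_eq, hEQ, Fintype.card_fin] at h
  -- The falling factorial is at least `(2|E| - 3)^4`, and `|E| ≥ 3` because `|Q| ≥ 6`.
  have hdesc : Fintype.card E ^ 4 ≤ (Fintype.card Q).descFactorial 4 := by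
    refine le_trans ?_ (Nat.pow_sub_le_descFactorial _ _)
    exact Nat.pow_le_pow_left (by omega) _
  set A := (Finset.univ.filter fun σ : E × Bool ≃ Q =>
    edgeAt (g ∘ σ) j = edgeAt (g ∘ σ) i).card
  have h3 : Fintype.card E ^ 2 * (Fintype.card E ^ 2 * A) ≤
      Fintype.card E ^ 2 * (8 * d ^ 2 * Fintype.card (E × Bool ≃ Q)) := by
    calc _ = Fintype.card E ^ 4 * A := by ring
      _ ≤ (Fintype.card Q).descFactorial 4 * A := Nat.mul_le_mul_right _ hdesc
      _ = _ := h
      _ ≤ (2 * (Fintype.card Q * d) ^ 2) * Fintype.card (E × Bool ≃ Q) :=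
        Nat.mul_le_mul_right _ (by convert h2)
      _ = _ := by rw [← hE]; ring
  exact Nat.le_of_mul_le_mul_left h3 (by have : 0 < Fintype.card E := by omega
                                         positivity)

open scoped Classical in
-- An edge is a loop with probability at most `2d/|E|`, and two given edges are parallel with
-- probability at most `8d²/|E|²`. Summing over edges and over pairs of edges gives an average
-- independent of `|E|`.
theorem sum_card_defects_le (hg : ∀ v : V, {q | g q = v}.ncard ≤ d)
    (hEQ : Fintype.card (E × Bool) = Fintype.card Q) (hQ : 6 ≤ Fintype.card Q) :
    ∑ σ : E × Bool ≃ Q, (defects (g ∘ σ)).card ≤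
      (2 * d + 8 * d ^ 2) * Fintype.card (E × Bool ≃ Q) := by
  have hE : Fintype.card E * 2 = Fintype.card Q := by simpa using hEQ
  have hE0 : 0 < Fintype.card E := by omega
  set L : E → ℕ := fun i =>
    (Finset.univ.filter fun σ : E × Bool ≃ Q => g (σ (i, false)) = g (σ (i, true))).card
  set B : E → E → ℕ := fun i j =>
    (Finset.univ.filter fun σ : E × Bool ≃ Q => edgeAt (g ∘ σ) j = edgeAt (g ∘ σ) i).card
  set F := Fintype.card (E × Bool ≃ Q)
  have h1 : ∑ σ : E × Bool ≃ Q, (defects (g ∘ σ)).card ≤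
      ∑ i : E, (L i + ∑ j ∈ Finset.univ.erase i, B i j) := by
    have := Finset.sum_card_bipartiteAbove_eq_sum_card_bipartiteBelow
      (s := (Finset.univ : Finset (E × Bool ≃ Q))) (t := (Finset.univ : Finset E))
      (fun (σ : E × Bool ≃ Q) i => IsDefect (g ∘ σ) i)
    simp only [Finset.bipartiteAbove, Finset.bipartiteBelow] at this
    refine (le_of_eq this).trans (Finset.sum_le_sum fun i _ => ?_)
    have hsub : (Finset.univ.filter fun σ : E × Bool ≃ Q => IsDefect (g ∘ σ) i) ⊆
        (Finset.univ.filter fun σ : E × Bool ≃ Q => g (σ (i, false)) = g (σ (i, true))) ∪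
        (Finset.univ.erase i).biUnion fun j =>
          Finset.univ.filter fun σ : E × Bool ≃ Q => edgeAt (g ∘ σ) j = edgeAt (g ∘ σ) i := by
      intro σ hσ
      have := (Finset.mem_filter.1 hσ).2
      simpa [IsDefect] using this
    exact (Finset.card_le_card hsub).trans ((Finset.card_union_le _ _).trans
      (Nat.add_le_add_left Finset.card_biUnion_le _))
  have h2 : ∑ i : E, Fintype.card E * L i ≤ Fintype.card E * (2 * d * F) := by
    refine (Finset.sum_le_card_nsmul _ _ (2 * d * F) fun i _ => card_loop_le g hg hEQ hQ i).trans ?_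
    simp
  have h3 : ∑ i : E, ∑ j ∈ Finset.univ.erase i, Fintype.card E ^ 2 * B i j ≤
      Fintype.card E ^ 2 * (8 * d ^ 2 * F) := by
    calc _ ≤ ∑ i : E, ∑ j ∈ Finset.univ.erase i, 8 * d ^ 2 * F :=
          Finset.sum_le_sum fun i _ => Finset.sum_le_sum fun j hj =>
            card_parallel_le g hg hEQ hQ (Finset.ne_of_mem_erase hj)
      _ ≤ ∑ i : E, ∑ j : E, 8 * d ^ 2 * F :=
          Finset.sum_le_sum fun i _ => Finset.sum_le_sum_of_subset (Finset.erase_subset _ _)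
      _ = _ := by simp; ring
  rw [← Finset.mul_sum] at h2
  simp only [← Finset.mul_sum] at h3
  have h2' := Nat.le_of_mul_le_mul_left h2 hE0
  have h3' := Nat.le_of_mul_le_mul_left h3 (by positivity)
  rw [Finset.sum_add_distrib] at h1
  calc _ ≤ _ := h1
    _ ≤ 2 * d * F + 8 * d ^ 2 * F := Nat.add_le_add h2' h3'
    _ = _ := by ring

open scoped Classical in
/-- A fixed polynomial proportion of all pairings is simple. -/
theorem card_equiv_le_mul_card_simple (hg : ∀ v : V, {q | g q = v}.ncard ≤ d)
    (hEQ : Fintype.card (E × Bool) = Fintype.card Q) (hQ : 6 ≤ Fintype.card Q)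
    (hE : 2 * (2 * d + 8 * d ^ 2) + (2 * d + 2) * d < Fintype.card E) :
    Fintype.card (E × Bool ≃ Q) ≤
      2 * ((Fintype.card (E × Bool)) ^ (2 * (2 * (2 * d + 8 * d ^ 2))) *
        (Finset.univ.filter fun σ : E × Bool ≃ Q => defects (g ∘ σ) = ∅).card) := by
  set K := 2 * d + 8 * d ^ 2
  have h1 := card_defects_le (k := 2 * K) g hg hE
  have h2 := sum_card_defects_le g hg hEQ hQ
  set F := Fintype.card (E × Bool ≃ Q)
  have h3 : (2 * K + 1) *
      (Finset.univ.filter fun σ : E × Bool ≃ Q => ¬(defects (g ∘ σ)).card ≤ 2 * K).card ≤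
      ∑ σ : E × Bool ≃ Q, (defects (g ∘ σ)).card := by
    rw [mul_comm, ← smul_eq_mul]
    refine (Finset.card_nsmul_le_sum _ (fun σ : E × Bool ≃ Q => (defects (g ∘ σ)).card) _ ?_).trans
      (Finset.sum_le_sum_of_subset (Finset.filter_subset _ _))
    intro σ hσ
    have := (Finset.mem_filter.1 hσ).2
    omega
  have h4 := Finset.card_filter_add_card_filter_not (s := Finset.univ)
    (fun σ : E × Bool ≃ Q => (defects (g ∘ σ)).card ≤ 2 * K)
  rw [Finset.card_univ] at h4
  have hF : Fintype.card (E × Bool ≃ Q) = F := rfl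
  rw [hF] at h4
  set A := (Finset.univ.filter fun σ : E × Bool ≃ Q => (defects (g ∘ σ)).card ≤ 2 * K).card
  set B := (Finset.univ.filter fun σ : E × Bool ≃ Q => ¬(defects (g ∘ σ)).card ≤ 2 * K).card
  -- Markov's inequality: at least half of the pairings have at most `2K` defects, and `h1` then
  -- switches these away.
  have h5 : F ≤ 2 * A := by
    by_contra! h
    have h6 : F + 1 ≤ 2 * B := by omega
    have h7 : (2 * K + 1) * (F + 1) ≤ 2 * (K * F) := by
      calc _ ≤ (2 * K + 1) * (2 * B) := Nat.mul_le_mul_left _ h6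
        _ = 2 * ((2 * K + 1) * B) := by ring
        _ ≤ _ := Nat.mul_le_mul_left _ (h3.trans h2)
    nlinarith
  exact h5.trans (Nat.mul_le_mul_left _ h1)

end Defects

/-! ### Bijections with a prescribed composite. -/

section Fibres

variable {P Q ι : Type*} [Fintype P] [DecidableEq P] [Fintype Q] [DecidableEq Q] [Fintype ι]

open scoped Classical Nat in
-- These bijections form a coset of the stabiliser of `h` in the permutations of `Q`, which is a
-- product of symmetric groups on the fibres.
theorem card_equiv_comp_eq (h : Q → ι) (σ₀ : P ≃ Q) :
    (Finset.univ.filter fun σ : P ≃ Q => h ∘ σ = h ∘ σ₀).card =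
      ∏ i, ((Finset.univ.filter fun q => h q = i).card)! := by
  have h1 := DomMulAct.stabilizer_card h
  rw [Fintype.card_subtype] at h1
  simp only [Fintype.card_subtype] at h1
  rw [← h1]
  refine Finset.card_bij (fun σ _ => σ₀.symm.trans σ) ?_ ?_ ?_
  · intro σ hσ
    simp only [Finset.mem_filter, Finset.mem_univ, true_and] at hσ ⊢
    ext q
    simpa using congrFun hσ (σ₀.symm q)
  · intro σ _ τ _ he
    ext p
    simpa using congrArg (fun e : Equiv.Perm Q => e (σ₀ p)) he
  · intro ρ hρ
    refine ⟨σ₀.trans ρ, ?_, ?_⟩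
    · simp only [Finset.mem_filter, Finset.mem_univ, true_and] at hρ ⊢
      ext p
      simpa using congrFun hρ (σ₀ p)
    · ext q; simp

open scoped Classical Nat in
theorem card_equiv_comp_le (h : Q → ι) (τ : P → ι) :
    (Finset.univ.filter fun σ : P ≃ Q => h ∘ σ = τ).card ≤
      ∏ i, ((Finset.univ.filter fun q => h q = i).card)! := by
  by_cases hτ : ∃ σ₀ : P ≃ Q, h ∘ σ₀ = τ
  · obtain ⟨σ₀, rfl⟩ := hτ
    exact (card_equiv_comp_eq h σ₀).le
  · rw [Finset.filter_false_of_mem fun σ _ hσ => hτ ⟨σ, hσ⟩]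
    simp

open scoped Classical in
theorem exists_equiv_comp_eq {P Q ι : Type*} [Fintype P] [Fintype Q] (h : Q → ι) (τ : P → ι)
    (hc : ∀ i, (Finset.univ.filter fun p => τ p = i).card =
      (Finset.univ.filter fun q => h q = i).card) : ∃ σ : P ≃ Q, h ∘ σ = τ := by
  have : ∀ i, Nonempty ({p // τ p = i} ≃ {q // h q = i}) := by
    intro i
    rw [← Fintype.card_eq, Fintype.card_subtype, Fintype.card_subtype, hc]
  let e := fun i => (this i).some
  refine ⟨(Equiv.sigmaFiberEquiv τ).symm.trans ((Equiv.sigmaCongrRight e).trans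
    (Equiv.sigmaFiberEquiv h)), funext fun p => ?_⟩
  exact ((e (τ p)) ⟨p, rfl⟩).2

end Fibres

/-! ### Simple graphs as multigraphs with numbered, oriented edges. -/

section Represents

variable {E V : Type*}

/-- The multigraph described by `f` is the simple graph `G`. -/
def Represents (f : E × Bool → V) (G : SimpleGraph V) : Prop :=
  Function.Injective (edgeAt f) ∧ Set.range (edgeAt f) = G.edgeSet

theorem Represents.unique {f : E × Bool → V} {G G' : SimpleGraph V} (h : Represents f G)
    (h' : Represents f G') : G = G' :=
  SimpleGraph.edgeSet_inj.1 (h.2.symm.trans h'.2)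

theorem exists_represents [Fintype E] {f : E × Bool → V} (hf : defects f = ∅) :
    ∃ G, Represents f G := by
  have hd : ∀ i, ¬IsDefect f i := by
    intro i hi
    have : i ∈ defects f := by simpa [defects] using hi
    simp [hf] at this
  refine ⟨SimpleGraph.fromEdgeSet (Set.range (edgeAt f)), ?_, ?_⟩
  · intro i j hij
    by_contra hne
    exact hd j (Or.inr ⟨i, hne, hij⟩)
  · rw [SimpleGraph.edgeSet_fromEdgeSet, eq_comm, sdiff_eq_left, Set.disjoint_left]
    rintro e ⟨i, rfl⟩ hi
    exact hd i (Or.inl (by simpa [edgeAt] using hi))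

theorem Represents.adj {f : E × Bool → V} {G : SimpleGraph V} (h : Represents f G)
    (p : E × Bool) : G.Adj (f p) (f (p.1, !p.2)) := by
  have : edgeAt f p.1 ∈ G.edgeSet := by rw [← h.2]; exact ⟨_, rfl⟩
  rcases p with ⟨i, _ | _⟩
  · exact this
  · exact SimpleGraph.Adj.symm this

theorem Represents.exists_of_adj {f : E × Bool → V} {G : SimpleGraph V} (h : Represents f G)
    {v w : V} (hvw : G.Adj v w) : ∃ p : E × Bool, f p = v ∧ f (p.1, !p.2) = w := by
  have : s(v, w) ∈ Set.range (edgeAt f) := by rw [h.2]; exact hvw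
  obtain ⟨i, hi⟩ := this
  rcases Sym2.eq_iff.1 hi with ⟨h1, h2⟩ | ⟨h1, h2⟩
  · exact ⟨(i, false), h1, h2⟩
  · exact ⟨(i, true), h2, h1⟩

theorem Represents.ncard_neighborSet {f : E × Bool → V} {G : SimpleGraph V} (h : Represents f G)
    (v : V) : {p | f p = v}.ncard = (G.neighborSet v).ncard := by
  refine Set.ncard_congr (fun p _ => f (p.1, !p.2)) ?_ ?_ ?_
  · rintro p rfl
    exact h.adj p
  · rintro p q hp hq hpq
    have he : ∀ p : E × Bool, edgeAt f p.1 = s(f p, f (p.1, !p.2)) := by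
      rintro ⟨i, _ | _⟩
      · rfl
      · exact Sym2.eq_swap
    have h1 : p.1 = q.1 := by
      apply h.1
      rw [he, he, hpq, show f p = f q from hp.trans hq.symm]
    rcases p with ⟨i, b⟩
    rcases q with ⟨j, c⟩
    obtain rfl : i = j := h1
    by_contra hne
    have hbc : c = !b := by
      rcases b <;> rcases c <;> simp_all
    subst hbc
    exact (h.adj (i, b)).ne (hp.trans hq.symm)
  · intro w hw
    obtain ⟨p, hp, hp'⟩ := h.exists_of_adj hw
    exact ⟨p, hp, hp'⟩

open scoped Classical in
theorem card_filter_sym2_mk_eq [Fintype V] {e : Sym2 V} (he : ¬e.IsDiag) :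
    (Finset.univ.filter fun a : V × V => s(a.1, a.2) = e).card = 2 := by
  induction e using Sym2.ind with
  | _ x y =>
    have hxy : x ≠ y := by simpa using he
    rw [Finset.card_eq_two]
    refine ⟨(x, y), (y, x), by simp [hxy], ?_⟩
    ext ⟨a, b⟩
    simp

open scoped Classical Nat in
-- A representation is a numbering of the edges of `G` together with an orientation of each.
theorem card_represents [Fintype E] [DecidableEq E] [Fintype V] (G : SimpleGraph V)
    (hG : G.edgeFinset.card = Fintype.card E) :
    (Finset.univ.filter fun f : E × Bool → V => Represents f G).card =
      (Fintype.card E)! * 2 ^ Fintype.card E := by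
  have hcard : Fintype.card E = Fintype.card G.edgeSet := by
    rw [← hG, SimpleGraph.edgeFinset_card]
  have h1 : (Finset.univ.filter fun f : E × Bool → V => Represents f G).card =
      ∑ ε : E ≃ G.edgeSet, (Finset.univ.filter fun f : E × Bool → V =>
        ∀ i, edgeAt f i = ε i).card := by
    rw [← Finset.card_biUnion]
    · congr 1
      ext f
      simp only [Finset.mem_filter, Finset.mem_univ, true_and, Finset.mem_biUnion]
      constructor
      · intro h
        refine ⟨(Equiv.ofInjective _ h.1).trans (Equiv.setCongr h.2), fun i => rfl⟩
      · rintro ⟨ε, hε⟩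
        have : edgeAt f = Subtype.val ∘ ε := funext hε
        refine ⟨?_, ?_⟩
        · rw [this]; exact Subtype.val_injective.comp ε.injective
        · rw [this, Set.range_comp, ε.range_eq_univ, Set.image_univ, Subtype.range_coe]
    · intro ε _ ε' _ hne
      rw [Function.onFun, Finset.disjoint_left]
      intro f hf hf'
      simp only [Finset.mem_filter, Finset.mem_univ, true_and] at hf hf'
      exact hne (Equiv.ext fun i => Subtype.ext ((hf i).symm.trans (hf' i)))
  have h2 : ∀ ε : E ≃ G.edgeSet, (Finset.univ.filter fun f : E × Bool → V =>
        ∀ i, edgeAt f i = ε i).card = 2 ^ Fintype.card E := by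
    intro ε
    have h3 : (Fintype.piFinset fun i : E => Finset.univ.filter fun a : V × V =>
        s(a.1, a.2) = (ε i : Sym2 V)).card = 2 ^ Fintype.card E := by
      rw [Fintype.card_piFinset, Finset.prod_congr rfl fun i _ => card_filter_sym2_mk_eq
        (G.not_isDiag_of_mem_edgeSet (ε i).2)]
      simp
    rw [← h3]
    refine Finset.card_bij (fun f _ i => (f (i, false), f (i, true))) ?_ ?_ ?_
    · intro f hf
      simpa [edgeAt] using (Finset.mem_filter.1 hf).2
    · intro f _ f' _ h
      ext ⟨i, b⟩
      have := congrFun h i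
      simp only [Prod.mk.injEq] at this
      cases b
      · exact this.1
      · exact this.2
    · intro a ha
      refine ⟨fun p => if p.2 then (a p.1).2 else (a p.1).1, ?_, ?_⟩
      · refine Finset.mem_filter.2 ⟨Finset.mem_univ _, ?_⟩
        simpa [edgeAt] using ha
      · ext i <;> simp
  rw [h1, Finset.sum_congr rfl fun ε _ => h2 ε, Finset.sum_const, Finset.card_univ,
    Fintype.card_equiv (Fintype.equivOfCardEq hcard), smul_eq_mul]

end Represents

/-! ### Transfer between pairings and regular graphs. -/

section Regular

theorem ncard_fst_eq {V : Type*} {d : ℕ} (v : V) : {q : V × Fin d | q.1 = v}.ncard = d := by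
  have : {q : V × Fin d | q.1 = v} = Set.range fun i : Fin d => (v, i) := by
    ext ⟨a, i⟩
    simp [eq_comm]
  rw [this, ← Set.image_univ, Set.ncard_image_of_injective _ (Prod.mk_right_injective v)]
  simp

open scoped Classical in
theorem card_edgeFinset_of_regular {E V : Type*} [Fintype E] [Fintype V] {d : ℕ} {G : SimpleGraph V} 
    (hG : ∀ v, (G.neighborSet v).ncard = d)
    (hE : 2 * Fintype.card E = Fintype.card V * d) : G.edgeFinset.card = Fintype.card E := by
  have h := G.sum_degrees_eq_twice_card_edges
  have hdeg : ∀ v, G.degree v = d := by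
    intro v
    rw [← hG v, Set.ncard_eq_toFinset_card', ← SimpleGraph.card_neighborFinset_eq_degree]
    rfl
  simp only [hdeg, Finset.sum_const, Finset.card_univ, smul_eq_mul] at h
  omega

variable {E V : Type*} [Fintype E] [DecidableEq E] [Fintype V] [DecidableEq V] {d : ℕ}

theorem card_filter_fst_eq (v : V) :
    (Finset.univ.filter fun q : V × Fin d => q.1 = v).card = d := by
  have := ncard_fst_eq (d := d) v
  rwa [Set.ncard_eq_toFinset_card', Set.toFinset_ofPred] at this

open scoped Classical Nat in
-- The count does not depend on `G`, so a uniform pairing conditioned on being simple is a uniform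
-- regular graph. The factor `d !` per vertex counts the labellings of its half-edges.
theorem card_pairings_of_regular {G : SimpleGraph V} (hG : ∀ v, (G.neighborSet v).ncard = d)
    (hE : 2 * Fintype.card E = Fintype.card V * d) :
    (Finset.univ.filter fun σ : E × Bool ≃ V × Fin d => Represents (Prod.fst ∘ σ) G).card =
      (Fintype.card E)! * 2 ^ Fintype.card E * d ! ^ Fintype.card V := by
  rw [← card_represents G (card_edgeFinset_of_regular hG hE), ← smul_eq_mul, ← Finset.sum_const]
  rw [Finset.card_eq_sum_card_fiberwise (f := fun σ : E × Bool ≃ V × Fin d => Prod.fst ∘ σ)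
    (t := Finset.univ.filter fun f : E × Bool → V => Represents f G)]
  · refine Finset.sum_congr rfl fun f hf => ?_
    have hf : Represents f G := (Finset.mem_filter.1 hf).2
    obtain ⟨σ₀, hσ₀⟩ := exists_equiv_comp_eq (Q := V × Fin d) Prod.fst f (fun v => by
      have h1 := hf.ncard_neighborSet v
      rw [hG, Set.ncard_eq_toFinset_card', Set.toFinset_ofPred] at h1
      convert h1.trans (card_filter_fst_eq (d := d) v).symm)
    have h2 := card_equiv_comp_eq (Q := V × Fin d) Prod.fst σ₀
    rw [hσ₀] at h2
    rw [Finset.filter_filter]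
    have h3 : ∏ v : V, ((Finset.univ.filter fun q : V × Fin d => q.1 = v).card)! =
        d ! ^ Fintype.card V := by
      rw [← Finset.card_univ, ← Finset.prod_const]
      exact Finset.prod_congr rfl fun v _ => congrArg _ (by convert card_filter_fst_eq (d := d) v)
    refine Eq.trans ?_ (h2.trans (Eq.trans (by congr!) h3))
    congr 1
    ext σ
    simp only [Finset.mem_filter, Finset.mem_univ, true_and]
    exact ⟨fun h => h.2, fun h => ⟨h ▸ hf, h⟩⟩
  · intro σ hσ
    exact Finset.mem_coe.2 (Finset.mem_filter.2
      ⟨Finset.mem_univ _, (Finset.mem_filter.1 (Finset.mem_coe.1 hσ)).2⟩)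

open scoped Classical Nat in
theorem card_simple_pairings_le (hE : 2 * Fintype.card E = Fintype.card V * d) :
    (Finset.univ.filter fun σ : E × Bool ≃ V × Fin d => defects (Prod.fst ∘ σ) = ∅).card ≤
      (Finset.univ.filter fun G : SimpleGraph V => ∀ v, (G.neighborSet v).ncard = d).card *
        ((Fintype.card E)! * 2 ^ Fintype.card E * d ! ^ Fintype.card V) := by
  refine (Finset.card_le_card (t := (Finset.univ.filter fun G : SimpleGraph V =>
    ∀ v, (G.neighborSet v).ncard = d).biUnion fun G =>
      Finset.univ.filter fun σ : E × Bool ≃ V × Fin d => Represents (Prod.fst ∘ σ) G) ?_).trans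
    (Finset.card_biUnion_le_card_mul _ _ _ fun G hG =>
      (card_pairings_of_regular (Finset.mem_filter.1 hG).2 hE).le)
  intro σ hσ
  obtain ⟨G, hG⟩ := exists_represents (Finset.mem_filter.1 hσ).2
  simp only [Finset.mem_biUnion, Finset.mem_filter, Finset.mem_univ, true_and]
  refine ⟨G, fun v => ?_, hG⟩
  rw [← hG.ncard_neighborSet]
  refine Eq.trans ?_ (ncard_fst_eq (d := d) v)
  exact Set.ncard_congr (fun p _ => σ p) (fun p hp => hp)
    (fun p q _ _ h => σ.injective h) (fun q hq => ⟨σ.symm q, by simpa using hq, by simp⟩)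

open scoped Classical Nat in
-- Union bound over `t`: distinct graphs have disjoint sets of pairings, and each pairing of a bad
-- graph respects some `t ∈ T`.
theorem card_regular_mul_le {ι : Type*} (R : ι → ι → Prop) (T : Finset (V → ι))
    (B : SimpleGraph V → Prop) (hB : ∀ G, B G → ∃ t ∈ T, ∀ u v, G.Adj u v → R (t u) (t v))
    (hE : 2 * Fintype.card E = Fintype.card V * d) :
    (Finset.univ.filter fun G : SimpleGraph V =>
        (∀ v, (G.neighborSet v).ncard = d) ∧ B G).card *
        ((Fintype.card E)! * 2 ^ Fintype.card E * d ! ^ Fintype.card V) ≤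
      ∑ t ∈ T, (Finset.univ.filter fun σ : E × Bool ≃ V × Fin d =>
        ∀ i, R (t (σ (i, false)).1) (t (σ (i, true)).1)).card := by
  rw [← smul_eq_mul, ← Finset.sum_const, ← Finset.sum_congr rfl fun G hG =>
    card_pairings_of_regular (Finset.mem_filter.1 hG).2.1 hE, ← Finset.card_biUnion]
  · refine (Finset.card_le_card ?_).trans Finset.card_biUnion_le
    intro σ hσ
    simp only [Finset.mem_biUnion, Finset.mem_filter, Finset.mem_univ, true_and] at hσ ⊢
    obtain ⟨G, ⟨-, hG⟩, hσ⟩ := hσ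
    obtain ⟨t, ht, h⟩ := hB G hG
    exact ⟨t, ht, fun i => h _ _ (hσ.adj (i, false))⟩
  · intro G _ G' _ hne
    rw [Function.onFun, Finset.disjoint_left]
    intro σ hσ hσ'
    exact hne ((Finset.mem_filter.1 hσ).2.unique (Finset.mem_filter.1 hσ').2)

end Regular

/-! ### Generating-function bounds for typings and typed pairings. -/

section TypeCount

variable {ι : Type*} [Fintype ι] [DecidableEq ι]

theorem prod_comp_eq_prod_pow {A M : Type*} [Fintype A] [CommMonoid M] (t : A → ι) (z : ι → M)
    {n : ι → ℕ} (ht : ∀ i, (Finset.univ.filter fun a => t a = i).card = n i) :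
    ∏ a, z (t a) = ∏ i, z i ^ n i := by
  rw [← Finset.prod_fiberwise' Finset.univ t z]
  exact Finset.prod_congr rfl fun i _ => by rw [Finset.prod_const, ht]

/-- An exponential-weight bound for the number of functions with prescribed fibre sizes. -/
theorem card_functions_mul_prod_le {A : Type*} [Fintype A] [DecidableEq A] (n : ι → ℕ) :
    (Finset.univ.filter fun t : A → ι =>
      ∀ i, (Finset.univ.filter fun a => t a = i).card = n i).card * ∏ i, n i ^ n i ≤
      (∑ i, n i) ^ Fintype.card A := by
  calc _ = ∑ t ∈ Finset.univ.filter fun t : A → ι =>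
        ∀ i, (Finset.univ.filter fun a => t a = i).card = n i, ∏ a, n (t a) := by
        rw [← smul_eq_mul, ← Finset.sum_const]
        exact Finset.sum_congr rfl fun t ht =>
          (prod_comp_eq_prod_pow t n (Finset.mem_filter.1 ht).2).symm
    _ ≤ ∑ t : A → ι, ∏ a, n (t a) := Finset.sum_le_sum_of_subset (Finset.filter_subset _ _)
    _ = _ := by
        rw [← Fintype.piFinset_univ, ← Finset.prod_univ_sum]
        simp

open scoped Classical Nat in
/-- An exponential-weight bound for the number of pairings whose edges avoid certain pairs of
types. -/
theorem card_equiv_types_mul_prod_le {E Q : Type*} [Fintype E] [DecidableEq E] [Fintype Q]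
    [DecidableEq Q] (h : Q → ι) (R : ι → ι → Prop) {z : ι → ℝ} (hz : ∀ i, 0 ≤ z i) {n : ι → ℕ}
    (hn : ∀ i, (Finset.univ.filter fun q => h q = i).card = n i) :
    (Finset.univ.filter fun σ : E × Bool ≃ Q =>
        ∀ e, R (h (σ (e, false))) (h (σ (e, true)))).card * ∏ i, z i ^ n i ≤
      (∏ i, ((n i)! : ℝ)) *
        (∑ a : ι × ι with R a.1 a.2, z a.1 * z a.2) ^ Fintype.card E := by
  set S := Finset.univ.filter fun σ : E × Bool ≃ Q =>
    ∀ e, R (h (σ (e, false))) (h (σ (e, true)))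
  let T : Finset (E × Bool → ι) := Finset.univ.filter fun τ =>
    (∀ e, R (τ (e, false)) (τ (e, true))) ∧
      ∀ i, (Finset.univ.filter fun p => τ p = i).card = n i
  have hfib : ∀ τ : E × Bool → ι,
      (Finset.univ.filter fun σ : E × Bool ≃ Q => h ∘ σ = τ).card ≤ ∏ i, (n i)! := by
    intro τ
    have hprod : ∏ i, ((Finset.univ.filter fun q => h q = i).card)! = ∏ i, (n i)! :=
      Finset.prod_congr rfl fun i _ => by rw [hn i]
    rw [← hprod]
    convert card_equiv_comp_le h τ
  have h1 : S.card ≤ T.card * ∏ i, (n i)! := by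
    rw [Finset.card_eq_sum_card_fiberwise (f := fun σ : E × Bool ≃ Q => h ∘ σ) (t := T),
      ← smul_eq_mul]
    · refine Finset.sum_le_card_nsmul _ _ _ fun τ _ => le_trans ?_ (hfib τ)
      exact Finset.card_le_card fun σ hσ =>
        Finset.mem_filter.2 ⟨Finset.mem_univ _, (Finset.mem_filter.1 hσ).2⟩
    · intro σ hσ
      refine Finset.mem_coe.2 (Finset.mem_filter.2 ⟨Finset.mem_univ _,
        (Finset.mem_filter.1 (Finset.mem_coe.1 hσ)).2, fun i => ?_⟩)
      rw [← hn i]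
      refine Finset.card_bij (fun p _ => σ p) ?_ (fun p _ q _ h => σ.injective h) ?_
      · intro p hp
        simpa using hp
      · intro q hq
        exact ⟨σ.symm q, by simpa using hq, by simp⟩
  have h2 : (T.card : ℝ) * ∏ i, z i ^ n i ≤
      (∑ a : ι × ι with R a.1 a.2, z a.1 * z a.2) ^ Fintype.card E := by
    calc (T.card : ℝ) * ∏ i, z i ^ n i = ∑ τ ∈ T, ∏ p, z (τ p) := by
          rw [← nsmul_eq_mul, ← Finset.sum_const]
          exact Finset.sum_congr rfl fun τ hτ =>
            (prod_comp_eq_prod_pow τ z fun i => by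
              rw [← (Finset.mem_filter.1 hτ).2.2 i]).symm
      -- Dropping the constraint on fibre sizes lets the weighted sum factor over the edges.
      _ ≤ ∑ τ ∈ Finset.univ.filter fun τ : E × Bool → ι => ∀ e, R (τ (e, false)) (τ (e, true)),
            ∏ p, z (τ p) := by
          refine Finset.sum_le_sum_of_subset_of_nonneg ?_ fun τ _ _ =>
            Finset.prod_nonneg fun p _ => hz _
          intro τ hτ
          exact Finset.mem_filter.2 ⟨Finset.mem_univ _, (Finset.mem_filter.1 hτ).2.1⟩
      _ = ∑ a ∈ Fintype.piFinset fun _ : E => Finset.univ.filter fun a : ι × ι => R a.1 a.2,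
            ∏ e, z (a e).1 * z (a e).2 := by
          refine Finset.sum_bij (fun τ _ e => (τ (e, false), τ (e, true))) ?_ ?_ ?_ ?_
          · intro τ hτ
            simpa using (Finset.mem_filter.1 hτ).2
          · intro τ _ τ' _ he
            ext ⟨e, b⟩
            have := congrFun he e
            simp only [Prod.mk.injEq] at this
            cases b
            · exact this.1
            · exact this.2
          · intro a ha
            refine ⟨fun p => if p.2 then (a p.1).2 else (a p.1).1, ?_, ?_⟩
            · refine Finset.mem_filter.2 ⟨Finset.mem_univ _, ?_⟩
              simpa using ha
            · ext e <;> simp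
          · intro τ _
            rw [Fintype.prod_prod_type]
            exact Finset.prod_congr rfl fun e _ => by rw [Fintype.prod_bool, mul_comm]
      _ = _ := by
          have := Finset.prod_univ_sum
            (fun _ : E => Finset.univ.filter fun a : ι × ι => R a.1 a.2)
            (fun _ a => z a.1 * z a.2)
          rw [Finset.prod_const, Finset.card_univ] at this
          convert this.symm
  have h3 : 0 ≤ ∏ i, z i ^ n i := Finset.prod_nonneg fun i _ => pow_nonneg (hz i) _
  have h4 : (0 : ℝ) ≤ ∏ i, ((n i)! : ℝ) := by positivity
  calc (S.card : ℝ) * ∏ i, z i ^ n i ≤ (T.card * ∏ i, ((n i)! : ℝ)) * ∏ i, z i ^ n i := by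
        refine mul_le_mul_of_nonneg_right ?_ h3
        exact_mod_cast h1
    _ = (∏ i, ((n i)! : ℝ)) * (T.card * ∏ i, z i ^ n i) := by ring
    _ ≤ _ := mul_le_mul_of_nonneg_left h2 h4

end TypeCount

/-! ### Elementary Stirling and convexity estimates. -/

section Factorials

open Real

open scoped Nat in
theorem pow_self_le_factorial_mul_exp (k : ℕ) : (k : ℝ) ^ k ≤ k ! * exp k := by
  have h := Real.pow_div_factorial_le_exp (k : ℝ) (Nat.cast_nonneg k) k
  rwa [div_le_iff₀' (by positivity)] at h

open scoped Nat in
theorem factorial_mul_exp_le (k : ℕ) : (k ! : ℝ) * exp k ≤ 3 * (k + 1) * (k : ℝ) ^ k := by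
  -- The form `k! e^k ≤ e k^(k+1)` fails at `k = 0`, hence the shift. The inductive step is `(1 -
  -- 1/(j+1))^(j+1) ≤ 1/e`.
  have key : ∀ k : ℕ, ((k + 1)! : ℝ) * exp (k + 1 : ℕ) ≤ exp 1 * (k + 1 : ℕ) ^ (k + 2) := by
    intro k
    induction k with
    | zero => simp
    | succ k ih =>
      set j := k + 1 with hj
      have hj0 : (0 : ℝ) < j := by rw [hj]; positivity
      have h1 : exp 1 * (j : ℝ) ^ (j + 1) ≤ ((j + 1 : ℕ) : ℝ) ^ (j + 1) := by
        have h2 : (1 - 1 / ((j : ℝ) + 1)) ^ (j + 1) ≤ exp (-(1 / ((j : ℝ) + 1))) ^ (j + 1) := by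
          refine pow_le_pow_left₀ ?_ (Real.one_sub_le_exp_neg _) _
          rw [sub_nonneg, div_le_one (by positivity)]
          linarith
        rw [← Real.exp_nat_mul] at h2
        have h3 : ((j + 1 : ℕ) : ℝ) * -(1 / ((j : ℝ) + 1)) = -1 := by
          push_cast; field_simp
        have h4 : 1 - 1 / ((j : ℝ) + 1) = j / (j + 1) := by field_simp; ring
        rw [h3, h4, Real.exp_neg, div_pow, div_le_iff₀ (by positivity), inv_mul_eq_div,
          le_div_iff₀ (exp_pos 1)] at h2
        push_cast
        linarith
      have h5 : (((j + 1)! : ℕ) : ℝ) * exp ((j + 1 : ℕ) : ℝ) =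
          ((j + 1 : ℕ) : ℝ) * exp 1 * ((j ! : ℕ) * exp j) := by
        rw [Nat.factorial_succ]
        push_cast
        rw [Real.exp_add]
        ring
      rw [h5]
      calc _ ≤ ((j + 1 : ℕ) : ℝ) * exp 1 * (exp 1 * (j : ℝ) ^ (j + 1)) := by gcongr
        _ ≤ ((j + 1 : ℕ) : ℝ) * exp 1 * ((j + 1 : ℕ) : ℝ) ^ (j + 1) := by gcongr
        _ = _ := by ring
  cases k with
  | zero => simp
  | succ k =>
    refine (key k).trans ?_
    have h3 : exp 1 ≤ 3 := by linarith [Real.exp_one_lt_d9]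
    calc exp 1 * ((k + 1 : ℕ) : ℝ) ^ (k + 2)
        = exp 1 * ((k + 1 : ℕ) : ℝ) * ((k + 1 : ℕ) : ℝ) ^ (k + 1) := by ring
      _ ≤ 3 * (((k + 1 : ℕ) : ℝ) + 1) * ((k + 1 : ℕ) : ℝ) ^ (k + 1) := by
        gcongr
        linarith

/-- Convexity of `t log t`. This shows that balanced pairs, `x = y`, are the worst case in the count
of typings. -/
theorem half_add_pow_le (x y : ℕ) :
    (((x : ℝ) + y) / 2) ^ (x + y) ≤ (x : ℝ) ^ x * (y : ℝ) ^ y := by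
  have hexp : ∀ k : ℕ, (k : ℝ) ^ k = exp (k * log k) := by
    intro k
    rcases Nat.eq_zero_or_pos k with rfl | hk
    · simp
    · rw [Real.exp_nat_mul, Real.exp_log (by exact_mod_cast hk)]
  rcases Nat.eq_zero_or_pos (x + y) with h0 | h0
  · obtain ⟨rfl, rfl⟩ : x = 0 ∧ y = 0 := by omega
    simp
  have hpos : 0 < ((x : ℝ) + y) / 2 := by
    have : (0 : ℝ) < ((x + y : ℕ) : ℝ) := by exact_mod_cast h0
    push_cast at this
    linarith
  rw [hexp x, hexp y, ← Real.exp_add, ← Real.exp_log hpos, ← Real.exp_nat_mul,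
    Real.exp_le_exp]
  have h := Real.convexOn_mul_log.2 (x := (x : ℝ)) (y := (y : ℝ)) (by simp) (by simp)
    (show (0 : ℝ) ≤ 1 / 2 by norm_num) (show (0 : ℝ) ≤ 1 / 2 by norm_num) (by norm_num)
  simp only [smul_eq_mul] at h
  have e : (1 / 2 : ℝ) * x + 1 / 2 * y = ((x : ℝ) + y) / 2 := by ring
  rw [e] at h
  push_cast
  linarith

end Factorials

/-! ### The first-moment bound for bad regular graphs. -/

section Bound

open scoped Classical Nat in
-- Each type gets its size as weight, times a free parameter `u` for the four types in forbidden
-- pairs. Stirling's estimate then cancels the powers of the class sizes, so the bound depends on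
-- `x` and `y` only through `x + y`.
theorem card_equiv_typing_mul_le {E V : Type*} [Fintype E] [DecidableEq E] [Fintype V]
    [DecidableEq V] {d x y r : ℕ} {t : V → Fin 5} (ht : HasTypeSizes t x y r) {u : ℝ} (hu : 0 < u)
    (hV : 2 * (x + y) + r = Fintype.card V) :
    (Finset.univ.filter fun σ : E × Bool ≃ V × Fin d =>
        ∀ e, ¬ForbiddenTypes (t (σ (e, false)).1) (t (σ (e, true)).1)).card *
        (u ^ (2 * (x + y) * d) * (Fintype.card V : ℝ) ^ (Fintype.card V * d)) ≤
      (3 * ((Fintype.card V * d : ℕ) + 1)) ^ 5 * (Fintype.card V * d)! *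
        ((2 * (x + y) * u + r) ^ 2 - (x + y) ^ 2 * u ^ 2) ^ Fintype.card E := by
  set N := Fintype.card V with hN
  let c : Fin 5 → ℕ := ![x, x, y, y, r]
  let w : Fin 5 → ℝ := ![u, u, u, u, 1]
  have hw : ∀ i, 0 ≤ w i := by
    intro i; fin_cases i <;> simp [w, hu.le]
  let z : Fin 5 → ℝ := fun i => c i * w i
  have hz : ∀ i, 0 ≤ z i := fun i => mul_nonneg (Nat.cast_nonneg _) (hw i)
  have hc : ∀ i, (Finset.univ.filter fun q : V × Fin d => t q.1 = i).card = c i * d := by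
    intro i
    have : (Finset.univ.filter fun q : V × Fin d => t q.1 = i) =
        (Finset.univ.filter fun v => t v = i) ×ˢ Finset.univ := by
      ext q; simp
    rw [this, Finset.card_product, ht i, Finset.card_univ, Fintype.card_fin]
  have h := card_equiv_types_mul_prod_le (E := E) (fun q : V × Fin d => t q.1)
    (fun i j => ¬ForbiddenTypes i j) hz hc
  set A := (Finset.univ.filter fun σ : E × Bool ≃ V × Fin d =>
        ∀ e, ¬ForbiddenTypes (t (σ (e, false)).1) (t (σ (e, true)).1)).card
  have hsum : ∑ i, c i = N := by
    rw [Fin.sum_univ_five]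
    simp only [c, Matrix.cons_val]
    omega
  -- The forbidden ordered pairs carry weight `2(x² + y²)u²`, which is at least `(x + y)²u²`.
  have hQ : (∑ a : Fin 5 × Fin 5 with ¬ForbiddenTypes a.1 a.2, z a.1 * z a.2) ≤
      (2 * (x + y) * u + r) ^ 2 - (x + y) ^ 2 * u ^ 2 := by
    rw [Finset.sum_filter, Fintype.sum_prod_type]
    simp only [Fin.sum_univ_five, ForbiddenTypes]
    simp [z, c, w]
    nlinarith [mul_nonneg (sq_nonneg ((x : ℝ) - y)) (sq_nonneg u)]
  have hQ0 : 0 ≤ ∑ a : Fin 5 × Fin 5 with ¬ForbiddenTypes a.1 a.2, z a.1 * z a.2 :=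
    Finset.sum_nonneg fun a _ => mul_nonneg (hz _) (hz _)
  have hzprod : ∏ i, z i ^ (c i * d) = (∏ i, (c i : ℝ) ^ (c i * d)) * u ^ (2 * (x + y) * d) := by
    simp only [z, mul_pow, Finset.prod_mul_distrib]
    congr 1
    rw [Fin.prod_univ_five]
    simp only [w, c, Matrix.cons_val, one_pow, mul_one]
    rw [← pow_add, ← pow_add, ← pow_add]
    congr 1
    ring
  have hcpos : 0 < ∏ i, (c i : ℝ) ^ (c i * d) := by
    refine Finset.prod_pos fun i _ => ?_
    rcases Nat.eq_zero_or_pos (c i) with h0 | h0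
    · simp [h0]
    · positivity
  have hfac : (∏ i, ((c i * d)! : ℝ)) * Real.exp (N * d : ℕ) ≤
      (3 * ((N * d : ℕ) + 1)) ^ 5 * (d : ℝ) ^ (N * d) * ∏ i, (c i : ℝ) ^ (c i * d) := by
    have e1 : Real.exp (N * d : ℕ) = ∏ i, Real.exp (c i * d : ℕ) := by
      rw [← Real.exp_sum, ← Nat.cast_sum, ← Finset.sum_mul, hsum]
    have e2 : (d : ℝ) ^ (N * d) = ∏ i, (d : ℝ) ^ (c i * d) := by
      rw [Finset.prod_pow_eq_pow_sum, ← Finset.sum_mul, hsum]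
    have e3 : ((3 : ℝ) * ((N * d : ℕ) + 1)) ^ 5 = ∏ i : Fin 5, (3 : ℝ) * ((N * d : ℕ) + 1) := by
      simp
    rw [e1, e2, e3, ← Finset.prod_mul_distrib, ← Finset.prod_mul_distrib, ← Finset.prod_mul_distrib]
    refine Finset.prod_le_prod (fun i _ => by positivity) fun i _ => ?_
    refine (factorial_mul_exp_le (c i * d)).trans ?_
    rw [mul_assoc _ ((d : ℝ) ^ _), ← mul_pow, mul_comm (d : ℝ), ← Nat.cast_mul]
    have : c i * d ≤ N * d := Nat.mul_le_mul_right _ (by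
      rw [← hsum]; exact Finset.single_le_sum (fun _ _ => Nat.zero_le _) (Finset.mem_univ i))
    gcongr
  rw [hzprod] at h
  have hfac2 := pow_self_le_factorial_mul_exp (N * d)
  set F := ((N * d)! : ℝ)
  set Q := ∑ a : Fin 5 × Fin 5 with ¬ForbiddenTypes a.1 a.2, z a.1 * z a.2
  set B := (2 * ((x : ℝ) + y) * u + r) ^ 2 - (x + y) ^ 2 * u ^ 2
  set C := ∏ i, (c i : ℝ) ^ (c i * d)
  set U := u ^ (2 * (x + y) * d)
  set G := ∏ i, ((c i * d)! : ℝ)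
  set X := Real.exp (N * d : ℕ)
  set p := ((3 : ℝ) * ((N * d : ℕ) + 1)) ^ 5
  have hB : Q ^ Fintype.card E ≤ B ^ Fintype.card E := pow_le_pow_left₀ hQ0 hQ _
  have hB0 : 0 ≤ B ^ Fintype.card E := pow_nonneg (hQ0.trans hQ) _
  have hX : 0 < X := Real.exp_pos _
  have hU : 0 < U := by positivity
  have hp : 0 < p := by positivity
  have h' : (A : ℝ) * (C * U) ≤ G * Q ^ Fintype.card E := by convert h
  have h1 : A * U * X ≤ p * (d : ℝ) ^ (N * d) * B ^ Fintype.card E := by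
    have : (A * U * X) * C ≤ (p * (d : ℝ) ^ (N * d) * B ^ Fintype.card E) * C := by
      calc (A * U * X) * C = (A * (C * U)) * X := by ring
        _ ≤ (G * Q ^ Fintype.card E) * X := mul_le_mul_of_nonneg_right h' hX.le
        _ = (G * X) * Q ^ Fintype.card E := by ring
        _ ≤ (p * (d : ℝ) ^ (N * d) * C) * Q ^ Fintype.card E :=
          mul_le_mul_of_nonneg_right hfac (pow_nonneg hQ0 _)
        _ ≤ (p * (d : ℝ) ^ (N * d) * C) * B ^ Fintype.card E :=
          mul_le_mul_of_nonneg_left hB (by positivity)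
        _ = _ := by ring
    exact le_of_mul_le_mul_right this hcpos
  rcases Nat.eq_zero_or_pos d with hd | hd
  · subst hd
    simp only [Nat.mul_zero, pow_zero, mul_one, X, Nat.cast_zero, Real.exp_zero] at h1 ⊢
    simpa [F, U] using h1
  have hdpos : (0 : ℝ) < (d : ℝ) ^ (N * d) := by positivity
  have h2 : (A * (U * (N : ℝ) ^ (N * d))) * (X * (d : ℝ) ^ (N * d)) ≤
      (p * F * B ^ Fintype.card E) * (X * (d : ℝ) ^ (N * d)) := by
    calc _ = (A * U * X) * ((N * d : ℕ) : ℝ) ^ (N * d) := by push_cast; rw [mul_pow]; ring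
      _ ≤ (p * (d : ℝ) ^ (N * d) * B ^ Fintype.card E) * (F * X) :=
        mul_le_mul h1 hfac2 (by positivity) (by positivity)
      _ = _ := by ring
  exact le_of_mul_le_mul_right h2 (by positivity)

open scoped Classical in
/-- All type assignments with `s` vertices on each side of the two forbidden pairs. -/
noncomputable def typings (V : Type*) [Fintype V] (s r : ℕ) : Finset (V → Fin 5) :=
  Finset.univ.filter fun t => ∃ x y, x + y = s ∧ HasTypeSizes t x y r

theorem mem_typings {V : Type*} [Fintype V] {s r : ℕ} {t : V → Fin 5} :
    t ∈ typings V s r ↔ ∃ x y, x + y = s ∧ HasTypeSizes t x y r := by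
  simp [typings]

/-- There are `s + 1` choices of `x`. For each, the multinomial bound is at most its value at the
balanced split. -/
theorem card_typings_mul_le {V : Type*} [Fintype V] {s r : ℕ}
    (hV : 2 * s + r = Fintype.card V) :
    ((typings V s r).card : ℝ) * (((s : ℝ) / 2) ^ (2 * s) * (r : ℝ) ^ r) ≤
      (s + 1) * (Fintype.card V : ℝ) ^ Fintype.card V := by
  classical
  let T : ℕ → Finset (V → Fin 5) := fun x => Finset.univ.filter fun t =>
    ∀ i, (Finset.univ.filter fun a => t a = i).card = ![x, x, s - x, s - x, r] i
  have hsub : typings V s r ⊆ (Finset.range (s + 1)).biUnion T := by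
    intro t ht
    obtain ⟨x, y, hxy, h⟩ := mem_typings.1 ht
    obtain rfl : y = s - x := by omega
    refine Finset.mem_biUnion.2 ⟨x, Finset.mem_range.2 (by omega), ?_⟩
    refine Finset.mem_filter.2 ⟨Finset.mem_univ _, fun i => ?_⟩
    rw [← h i]
  have hT : ∀ x ∈ Finset.range (s + 1), ((T x).card : ℝ) *
      (((s : ℝ) / 2) ^ (2 * s) * (r : ℝ) ^ r) ≤ (Fintype.card V : ℝ) ^ Fintype.card V := by
    intro x hx
    have hx : x ≤ s := by rw [Finset.mem_range] at hx; omega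
    have h : (T x).card * ∏ i, ![x, x, s - x, s - x, r] i ^ ![x, x, s - x, s - x, r] i ≤
        (∑ i, ![x, x, s - x, s - x, r] i) ^ Fintype.card V := by
      convert card_functions_mul_prod_le (A := V) (ι := Fin 5) ![x, x, s - x, s - x, r]
    rw [Fin.prod_univ_five, Fin.sum_univ_five] at h
    simp only [Matrix.cons_val] at h
    have e : x + x + (s - x) + (s - x) + r = Fintype.card V := by omega
    rw [e] at h
    have h' : ((T x).card : ℝ) * ((x : ℝ) ^ x * (x : ℝ) ^ x * ((s - x : ℕ) : ℝ) ^ (s - x) *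
        ((s - x : ℕ) : ℝ) ^ (s - x) * (r : ℝ) ^ r) ≤
        (Fintype.card V : ℝ) ^ Fintype.card V := by exact_mod_cast h
    refine le_trans (mul_le_mul_of_nonneg_left ?_ (Nat.cast_nonneg _)) h'
    have h2 := half_add_pow_le x (s - x)
    rw [← Nat.cast_add, Nat.add_sub_cancel' hx] at h2
    calc ((s : ℝ) / 2) ^ (2 * s) * (r : ℝ) ^ r
        = ((s : ℝ) / 2) ^ s * ((s : ℝ) / 2) ^ s * (r : ℝ) ^ r := by ring
      _ ≤ ((x : ℝ) ^ x * ((s - x : ℕ) : ℝ) ^ (s - x)) *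
          ((x : ℝ) ^ x * ((s - x : ℕ) : ℝ) ^ (s - x)) * (r : ℝ) ^ r := by gcongr
      _ = _ := by ring
  have h0 : 0 ≤ ((s : ℝ) / 2) ^ (2 * s) * (r : ℝ) ^ r := by positivity
  calc ((typings V s r).card : ℝ) * (((s : ℝ) / 2) ^ (2 * s) * (r : ℝ) ^ r)
      ≤ (∑ x ∈ Finset.range (s + 1), (T x).card : ℕ) *
        (((s : ℝ) / 2) ^ (2 * s) * (r : ℝ) ^ r) := by
        refine mul_le_mul_of_nonneg_right ?_ h0
        exact_mod_cast (Finset.card_le_card hsub).trans Finset.card_biUnion_le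
    _ = ∑ x ∈ Finset.range (s + 1), ((T x).card : ℝ) *
        (((s : ℝ) / 2) ^ (2 * s) * (r : ℝ) ^ r) := by
        rw [Nat.cast_sum, Finset.sum_mul]
    _ ≤ _ := by
        refine (Finset.sum_le_card_nsmul _ _ _ hT).trans (le_of_eq ?_)
        simp

open scoped Classical in
/-- The set of `d`-regular graphs, with regularity expressed through neighbour sets. -/
noncomputable def regularFinset (V : Type*) [Fintype V] (d : ℕ) : Finset (SimpleGraph V) :=
  Finset.univ.filter fun G => ∀ v, (G.neighborSet v).ncard = d

open scoped Classical in
/-- The `d`-regular graphs that admit a typing without edges between forbidden pairs of types. -/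
noncomputable def badFinset (V : Type*) [Fintype V] (d s r : ℕ) : Finset (SimpleGraph V) :=
  Finset.univ.filter fun G => (∀ v, (G.neighborSet v).ncard = d) ∧
    ∃ t ∈ typings V s r, ∀ u v, G.Adj u v → ¬ForbiddenTypes (t u) (t v)

theorem mem_regularFinset {V : Type*} [Fintype V] {d : ℕ} {G : SimpleGraph V} :
    G ∈ regularFinset V d ↔ ∀ v, (G.neighborSet v).ncard = d := by
  simp [regularFinset]

theorem mem_badFinset {V : Type*} [Fintype V] {d s r : ℕ} {G : SimpleGraph V} :
    G ∈ badFinset V d s r ↔ (∀ v, (G.neighborSet v).ncard = d) ∧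
      ∃ t ∈ typings V s r, ∀ u v, G.Adj u v → ¬ForbiddenTypes (t u) (t v) := by
  simp [badFinset]

open scoped Nat in
-- Compares bad graphs with all regular graphs through pairings. The number `C` of pairings per
-- graph cancels, and the proportion of simple pairings enters only through a polynomial factor.
theorem card_badFinset_mul_le {V : Type*} [Fintype V] {d s r m : ℕ}
    (hV : 2 * s + r = Fintype.card V) (hm : 2 * m = Fintype.card V * d) {u : ℝ} (hu : 0 < u)
    (hm6 : 3 ≤ m) (hmd : 2 * (2 * d + 8 * d ^ 2) + (2 * d + 2) * d < m) :
    0 < (regularFinset V d).card ∧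
    ((badFinset V d s r).card : ℝ) * ((((s : ℝ) / 2) ^ (2 * s) * (r : ℝ) ^ r) *
      (u ^ (2 * s * d) * (Fintype.card V : ℝ) ^ (Fintype.card V * d))) ≤
      (regularFinset V d).card *
        (2 * (s + 1) * (3 * ((Fintype.card V * d : ℕ) + 1)) ^ 5 *
          ((Fintype.card V * d : ℕ) : ℝ) ^ (2 * (2 * (2 * d + 8 * d ^ 2)))) *
        ((Fintype.card V : ℝ) ^ Fintype.card V *
          ((2 * s * u + r) ^ 2 - s ^ 2 * u ^ 2) ^ m) := by
  classical
  set N := Fintype.card V with hN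
  have hPQ : Fintype.card (Fin m × Bool) = Fintype.card (V × Fin d) := by
    simp [← hN]; omega
  have hQ : Fintype.card (V × Fin d) = N * d := by simp [← hN]
  have hfact : Fintype.card (Fin m × Bool ≃ V × Fin d) = (N * d)! := by
    rw [Fintype.card_equiv (Fintype.equivOfCardEq hPQ), hPQ, hQ]
  have hEc : 2 * Fintype.card (Fin m) = Fintype.card V * d := by simpa using hm
  have h1 := card_equiv_le_mul_card_simple (E := Fin m) (Q := V × Fin d) Prod.fst
    (fun v => (ncard_fst_eq v).le) hPQ (by rw [← hPQ]; simp; omega) (by simpa using hmd)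
  have h2 := card_simple_pairings_le (E := Fin m) (V := V) (d := d) hEc
  have h3 := card_regular_mul_le (E := Fin m) (V := V) (d := d)
    (fun i j => ¬ForbiddenTypes i j) (typings V s r)
    (fun G => ∃ t ∈ typings V s r, ∀ u v, G.Adj u v → ¬ForbiddenTypes (t u) (t v))
    (fun G h => h) hEc
  rw [hfact, hPQ, hQ] at h1
  set κ := 2 * (2 * (2 * d + 8 * d ^ 2))
  set C := (Fintype.card (Fin m))! * 2 ^ Fintype.card (Fin m) * d ! ^ Fintype.card V with hC
  have h1' : (N * d)! ≤ 2 * ((N * d) ^ κ * ((regularFinset V d).card * C)) := by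
    refine h1.trans (Nat.mul_le_mul_left _ (Nat.mul_le_mul_left _ (h2.trans (le_of_eq ?_))))
    congr!
  have hreg : 0 < (regularFinset V d).card := by
    rw [Nat.pos_iff_ne_zero]
    intro h0
    have := Nat.factorial_pos (N * d)
    simp [h0] at h1'
    omega
  refine ⟨hreg, ?_⟩
  have hC0 : 0 < C := by positivity
  set Y := u ^ (2 * s * d) * (N : ℝ) ^ (N * d) with hY
  have hY0 : 0 ≤ Y := by positivity
  set p := ((3 : ℝ) * ((N * d : ℕ) + 1)) ^ 5
  have hp0 : 0 < p := by positivity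
  set B := ((2 * (s : ℝ) * u + r) ^ 2 - s ^ 2 * u ^ 2) ^ m with hB
  have hB0 : 0 ≤ B := by
    refine pow_nonneg ?_ _
    have hs : 0 ≤ (s : ℝ) * u := by positivity
    have hr : (0 : ℝ) ≤ r := Nat.cast_nonneg _
    nlinarith [mul_nonneg hs hr]
  set Z := (((s : ℝ) / 2) ^ (2 * s) * (r : ℝ) ^ r)
  have hZ0 : 0 ≤ Z := by positivity
  have h4 : ((badFinset V d s r).card : ℝ) * C * Y ≤ (typings V s r).card * (p * (N * d)! * B) := by
    have h3' : ((badFinset V d s r).card : ℝ) * C ≤ ∑ t ∈ typings V s r,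
        ((Finset.univ.filter fun σ : Fin m × Bool ≃ V × Fin d =>
          ∀ i, ¬ForbiddenTypes (t (σ (i, false)).1) (t (σ (i, true)).1)).card : ℝ) := by
      rw [← Nat.cast_sum, ← Nat.cast_mul, Nat.cast_le]
      rw [badFinset]
      convert h3
    refine (mul_le_mul_of_nonneg_right h3' hY0).trans ?_
    rw [Finset.sum_mul, ← nsmul_eq_mul]
    refine Finset.sum_le_card_nsmul _ _ _ fun t ht => ?_
    obtain ⟨x, y, hxy, hsz⟩ := mem_typings.1 ht
    have h5 := card_equiv_typing_mul_le (E := Fin m) (d := d) hsz hu (by rw [hxy]; exact hV)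
    rw [hxy, ← Nat.cast_add, hxy, Fintype.card_fin, ← hN] at h5
    refine le_trans (le_of_eq ?_) (h5.trans (le_of_eq rfl))
    congr!
  have h6 := card_typings_mul_le hV
  rw [← hN] at h6
  have h7 : ((N * d)! : ℝ) ≤ 2 * (((N * d : ℕ) : ℝ) ^ κ * ((regularFinset V d).card * C)) := by
    exact_mod_cast h1'
  have hCr : (0 : ℝ) < C := by exact_mod_cast hC0
  refine le_of_mul_le_mul_right (a := (C : ℝ)) ?_ hCr
  calc ((badFinset V d s r).card : ℝ) * (Z * Y) * C
      = (((badFinset V d s r).card : ℝ) * C * Y) * Z := by ring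
    _ ≤ ((typings V s r).card * (p * (N * d)! * B)) * Z := mul_le_mul_of_nonneg_right h4 hZ0
    _ = ((typings V s r).card * Z) * (p * (N * d)! * B) := by ring
    _ ≤ ((s + 1) * (N : ℝ) ^ N) * (p * (N * d)! * B) :=
      mul_le_mul_of_nonneg_right h6 (by positivity)
    _ = ((s + 1) * (N : ℝ) ^ N * p * B) * (N * d)! := by ring
    _ ≤ ((s + 1) * (N : ℝ) ^ N * p * B) *
        (2 * (((N * d : ℕ) : ℝ) ^ κ * ((regularFinset V d).card * C))) :=
      mul_le_mul_of_nonneg_left h7 (by positivity)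
    _ = _ := by ring

end Bound

/-! ### The exponential rate, its sign, and the limit. -/

section Rate

open Real

/-- The exponential growth rate of the first-moment bound, when a proportion `ρ` of the vertices
lies outside the two forbidden pairs and the other vertices have weight `u`. -/
noncomputable def firstMomentRate (d : ℕ) (u ρ : ℝ) : ℝ :=
  -((1 - ρ) * log ((1 - ρ) / 4)) - ρ * log ρ +
    d / 2 * log (((1 - ρ) * u + ρ) ^ 2 - (1 - ρ) ^ 2 * u ^ 2 / 4) - d * (1 - ρ) * log u

theorem firstMomentRate_base_pos {u ρ : ℝ} (hu : 0 < u) (h0 : 0 < ρ) (h1 : ρ < 1) :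
    0 < ((1 - ρ) * u + ρ) ^ 2 - (1 - ρ) ^ 2 * u ^ 2 / 4 := by
  have h : 0 < (1 - ρ) * u := mul_pos (by linarith) hu
  nlinarith [mul_pos h h0]

theorem continuousAt_firstMomentRate (d : ℕ) {u ρ : ℝ} (hu : 0 < u) (h0 : 0 < ρ) (h1 : ρ < 1) :
    ContinuousAt (firstMomentRate d u) ρ := by
  have hb := firstMomentRate_base_pos hu h0 h1
  have h2 : (1 - ρ) / 4 ≠ 0 := by
    have : 0 < 1 - ρ := by linarith
    positivity
  unfold firstMomentRate
  fun_prop (disch := first | exact h2 | exact h0.ne' | exact hb.ne')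

theorem bound_eq_mul_exp_firstMomentRate {d s r m N : ℕ} {u : ℝ} (hu : 0 < u) (hs : 0 < s)
    (hr : 0 < r) (hN : 2 * s + r = N) (hm : 2 * m = N * d) :
    (N : ℝ) ^ N * ((2 * s * u + r) ^ 2 - s ^ 2 * u ^ 2) ^ m =
      ((((s : ℝ) / 2) ^ (2 * s) * (r : ℝ) ^ r) * (u ^ (2 * s * d) * (N : ℝ) ^ (N * d))) *
        exp (N * firstMomentRate d u (r / N)) := by
  have hN0 : 0 < N := by omega
  have hNr : (0 : ℝ) < N := by exact_mod_cast hN0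
  have hsr : (0 : ℝ) < s := by exact_mod_cast hs
  have hrr : (0 : ℝ) < r := by exact_mod_cast hr
  have hNe : (N : ℝ) = 2 * s + r := by rw [← hN]; push_cast; ring
  have hme : (m : ℝ) = N * d / 2 := by
    have : (2 * m : ℝ) = N * d := by exact_mod_cast hm
    linarith
  obtain ⟨ρ, hρ⟩ : ∃ ρ : ℝ, ρ = r / N := ⟨_, rfl⟩
  have hr' : (r : ℝ) = ρ * N := by rw [hρ]; field_simp
  have hs' : (s : ℝ) = (1 - ρ) * N / 2 := by
    have : (1 - ρ) * N = N - ρ * N := by ring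
    rw [this, ← hr', hNe]; ring
  have h0 : 0 < ρ := by rw [hρ]; positivity
  have h1 : 0 < 1 - ρ := by
    by_contra! h
    have : (s : ℝ) ≤ 0 := by
      rw [hs']
      have := mul_nonneg (neg_nonneg.2 h) hNr.le
      linarith
    linarith
  have hb := firstMomentRate_base_pos hu h0 (by linarith)
  rw [← hρ]
  have hB : (2 * (s : ℝ) * u + r) ^ 2 - s ^ 2 * u ^ 2 =
      N ^ 2 * (((1 - ρ) * u + ρ) ^ 2 - (1 - ρ) ^ 2 * u ^ 2 / 4) := by
    rw [hs', hr']; ring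
  rw [hB]
  have hs2 : (s : ℝ) / 2 = (1 - ρ) / 4 * N := by rw [hs']; ring
  have h14 : 0 < (1 - ρ) / 4 := by positivity
  unfold firstMomentRate
  set q := ((1 - ρ) * u + ρ) ^ 2 - (1 - ρ) ^ 2 * u ^ 2 / 4
  have hq : 0 < (N : ℝ) ^ 2 * q := by positivity
  -- Both sides are positive, so logarithms can be compared. The `log N` terms cancel because `2m =
  -- Nd` and `2s + r = N`.
  apply Real.log_injOn_pos (Set.mem_Ioi.2 (by positivity)) (Set.mem_Ioi.2 (by positivity))
  rw [Real.log_mul (by positivity) (by positivity), Real.log_pow, Real.log_pow,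
    Real.log_mul (by positivity) hb.ne', Real.log_pow,
    Real.log_mul (by positivity) (by positivity), Real.log_exp,
    Real.log_mul (by positivity) (by positivity), Real.log_mul (by positivity) (by positivity),
    Real.log_mul (by positivity) (by positivity), Real.log_pow, Real.log_pow, Real.log_pow,
    Real.log_pow, hs2, Real.log_mul h14.ne' hNr.ne', hme]
  have hlr : log (r : ℝ) = log ρ + log N := by rw [hr', Real.log_mul h0.ne' hNr.ne']
  rw [hlr]
  push_cast
  rw [hs', hr']
  ring

/-- The series of `2 artanh t` at `t = (x - 1)/(x + 1)`, which equals `log x` and converges fast for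
`x` near `1`. -/
theorem sum_range_le_log {x : ℝ} (hx : 1 ≤ x) (n : ℕ) :
    2 * ∑ i ∈ Finset.range n, ((x - 1) / (x + 1)) ^ (2 * i + 1) / (2 * i + 1) ≤ log x := by
  have h := Real.sum_range_le_log_div (x := (x - 1) / (x + 1))
    (div_nonneg (by linarith) (by linarith)) ((div_lt_one (by linarith)).2 (by linarith)) n
  have hx1 : x + 1 ≠ 0 := by linarith
  have e : (1 + (x - 1) / (x + 1)) / (1 - (x - 1) / (x + 1)) = x := by
    have h1 : 1 + (x - 1) / (x + 1) = 2 * x / (x + 1) := by field_simp; ring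
    have h2 : 1 - (x - 1) / (x + 1) = 2 / (x + 1) := by field_simp; ring
    rw [h1, h2]
    field_simp
  rw [e] at h
  linarith

theorem log_le_sum_range_add {x : ℝ} (hx : 1 ≤ x) (n : ℕ) :
    log x ≤ 2 * (∑ i ∈ Finset.range n, ((x - 1) / (x + 1)) ^ (2 * i + 1) / (2 * i + 1) +
      ((x - 1) / (x + 1)) ^ (2 * n + 1) / (1 - ((x - 1) / (x + 1)) ^ 2)) := by
  have h := Real.log_div_le_sum_range_add (x := (x - 1) / (x + 1))
    (div_nonneg (by linarith) (by linarith)) ((div_lt_one (by linarith)).2 (by linarith)) n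
  have hx1 : x + 1 ≠ 0 := by linarith
  have e : (1 + (x - 1) / (x + 1)) / (1 - (x - 1) / (x + 1)) = x := by
    have h1 : 1 + (x - 1) / (x + 1) = 2 * x / (x + 1) := by field_simp; ring
    have h2 : 1 - (x - 1) / (x + 1) = 2 / (x + 1) := by field_simp; ring
    rw [h1, h2]
    field_simp
  rw [e] at h
  linarith

/-- The weight `65/54` is close to the minimiser of the rate in `u`. The value is only about `-2 ·
10⁻⁵`, hence the eight-digit bounds. Powers of `2` are split off to bring the arguments close to
`1`. -/
theorem firstMomentRate_neg : firstMomentRate 27 (65 / 54) (10000 / 27403) < 0 := by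
  have l1 : 0.23913728 ≤ log (34806 / 27403) :=
    le_trans (by norm_num [Finset.sum_range_succ]) (sum_range_le_log (by norm_num) 5)
  have l2 : 0.37822695 ≤ log (40000 / 27403) :=
    le_trans (by norm_num [Finset.sum_range_succ]) (sum_range_le_log (by norm_num) 5)
  have l3 : 0.18540322 ≤ log (65 / 54) :=
    le_trans (by norm_num [Finset.sum_range_succ]) (sum_range_le_log (by norm_num) 5)
  have l4 : log 1.1293772 ≤ 0.12166634 :=
    (log_le_sum_range_add (by norm_num) 5).trans (by norm_num [Finset.sum_range_succ])
  have e1 : log ((1 - 10000 / 27403) / 4) = log (34806 / 27403) - 3 * log 2 := by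
    rw [show (1 - 10000 / 27403) / 4 = (34806 / 27403 : ℝ) / 2 ^ 3 by norm_num,
      Real.log_div (by norm_num) (by norm_num), Real.log_pow]
    norm_num
  have e2 : log (10000 / 27403) = log (40000 / 27403) - 2 * log 2 := by
    rw [show (10000 / 27403 : ℝ) = (40000 / 27403 : ℝ) / 2 ^ 2 by norm_num,
      Real.log_div (by norm_num) (by norm_num), Real.log_pow]
    norm_num
  have e3 : log (((1 - 10000 / 27403) * (65 / 54) + 10000 / 27403) ^ 2 -
      (1 - 10000 / 27403) ^ 2 * (65 / 54) ^ 2 / 4) ≤ 0.12166634 :=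
    (Real.log_le_log (by norm_num) (by norm_num)).trans l4
  -- In the rate `log 2` has the positive coefficient `3(1 - ρ) + 2ρ`, so an upper bound suffices.
  have h2 := Real.log_two_lt_d9
  rw [firstMomentRate, e1, e2]
  push_cast
  linarith

/-- If the growth rate at the limiting density is negative, then the bound on the proportion of bad
graphs tends to zero. -/
theorem tendsto_card_badFinset_div {d : ℕ} (hd : 0 < d) {u ρ : ℝ} (hu : 0 < u) (h0 : 0 < ρ)
    (h1 : ρ < 1) (hrate : firstMomentRate d u ρ < 0) {N s r : ℕ → ℕ}
    (hNd : ∀ k, Even (N k * d)) (hN : ∀ᶠ k in atTop, 2 * s k + r k = N k)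
    (hs : ∀ᶠ k in atTop, 0 < s k) (hr : ∀ᶠ k in atTop, 0 < r k) (hNt : Tendsto N atTop atTop)
    (hρ : Tendsto (fun k => (r k : ℝ) / N k) atTop (𝓝 ρ)) :
    (∀ᶠ k in atTop, 0 < (regularFinset (Fin (N k)) d).card) ∧
    Tendsto (fun k => ((badFinset (Fin (N k)) d (s k) (r k)).card : ℝ) /
      (regularFinset (Fin (N k)) d).card) atTop (𝓝 0) := by
  obtain ⟨κ, hκ⟩ : ∃ κ, κ = 2 * (2 * (2 * d + 8 * d ^ 2)) := ⟨_, rfl⟩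
  obtain ⟨ε, hε0, hε⟩ : ∃ ε > 0, firstMomentRate d u ρ < -ε :=
    ⟨-firstMomentRate d u ρ / 2, by linarith, by linarith⟩
  have hev : ∀ᶠ k in atTop, firstMomentRate d u (r k / N k) < -ε :=
    ((continuousAt_firstMomentRate d hu h0 h1).tendsto.comp hρ).eventually_lt_const hε
  -- Large enough that `m ≥ N/2` satisfies both size conditions of `card_badFinset_mul_le`.
  have hbig := hNt.eventually_ge_atTop
    (2 * (3 + (2 * (2 * d + 8 * d ^ 2) + (2 * d + 2) * d)) + 2)
  have hmain : ∀ᶠ k in atTop, 0 < (regularFinset (Fin (N k)) d).card ∧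
      ((badFinset (Fin (N k)) d (s k) (r k)).card : ℝ) / (regularFinset (Fin (N k)) d).card ≤
        31104 * ((N k : ℝ) * d) ^ (κ + 6) * exp (-(N k * ε)) := by
    filter_upwards [hN, hs, hr, hev, hbig] with k hN hs hr hev hbig
    obtain ⟨m, hm⟩ := hNd k
    have hm2 : 2 * m = N k * d := by omega
    have hNm : N k ≤ 2 * m := by rw [hm2]; exact Nat.le_mul_of_pos_right _ hd
    obtain ⟨hreg, h⟩ := card_badFinset_mul_le (V := Fin (N k)) (d := d) (by simpa using hN)
      (by simpa using hm2) hu (by omega) (by omega)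
    refine ⟨hreg, ?_⟩
    rw [Fintype.card_fin, bound_eq_mul_exp_firstMomentRate hu hs hr hN hm2, ← hκ] at h
    have hNpos : 0 < N k := by omega
    set D := (((s k : ℝ) / 2) ^ (2 * s k) * (r k : ℝ) ^ r k) *
      (u ^ (2 * s k * d) * (N k : ℝ) ^ (N k * d)) with hD
    have hD0 : 0 < D := by positivity
    have hregr : (0 : ℝ) < (regularFinset (Fin (N k)) d).card := by exact_mod_cast hreg
    rw [div_le_iff₀ hregr]
    refine le_of_mul_le_mul_right (h.trans ?_) hD0
    have hX : (1 : ℝ) ≤ (N k : ℝ) * d := by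
      exact_mod_cast Nat.mul_pos hNpos hd
    have hsX : (s k : ℝ) ≤ (N k : ℝ) * d := by
      have : s k ≤ N k * d := le_trans (by omega) (Nat.le_mul_of_pos_right (N k) hd)
      exact_mod_cast this
    push_cast
    set X := (N k : ℝ) * d
    -- Here `31104 = 4 · 6⁵`, from `s + 1 ≤ 2X` and `3(X + 1) ≤ 6X`.
    have hpoly : 2 * ((s k : ℝ) + 1) * (3 * (X + 1)) ^ 5 * X ^ κ ≤ 31104 * X ^ (κ + 6) := by
      calc 2 * ((s k : ℝ) + 1) * (3 * (X + 1)) ^ 5 * X ^ κ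
          ≤ 2 * (X + X) * (3 * (X + X)) ^ 5 * X ^ κ := by gcongr
        _ = _ := by ring
    have hexp : exp (N k * firstMomentRate d u (r k / N k)) ≤ exp (-(N k * ε)) := by
      rw [Real.exp_le_exp]
      have : (0 : ℝ) < N k := by exact_mod_cast hNpos
      nlinarith
    calc _ = ((regularFinset (Fin (N k)) d).card : ℝ) * D *
          (2 * ((s k : ℝ) + 1) * (3 * (X + 1)) ^ 5 * X ^ κ) *
            exp (N k * firstMomentRate d u (r k / N k)) := by ring
      _ ≤ ((regularFinset (Fin (N k)) d).card : ℝ) * D * (31104 * X ^ (κ + 6)) *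
            exp (-(N k * ε)) := by gcongr
      _ = _ := by ring
  refine ⟨hmain.mono fun k h => h.1, ?_⟩
  have hlim : Tendsto (fun k => 31104 * ((N k : ℝ) * d) ^ (κ + 6) * exp (-(N k * ε))) atTop
      (𝓝 0) := by
    have h2 : Tendsto (fun k => (N k : ℝ) * ε) atTop atTop :=
      (tendsto_natCast_atTop_atTop.comp hNt).atTop_mul_const hε0
    have h3 := ((Real.tendsto_pow_mul_exp_neg_atTop_nhds_zero (κ + 6)).comp h2).const_mul
      (31104 * (d / ε) ^ (κ + 6))
    rw [mul_zero] at h3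
    refine h3.congr fun k => ?_
    simp only [Function.comp_apply]
    rw [mul_assoc 31104, mul_assoc 31104, ← mul_assoc _ _ (exp _), ← mul_pow]
    congr 3
    field_simp
  exact squeeze_zero' (Eventually.of_forall fun k => by positivity) (hmain.mono fun k h => h.2)
    hlim

end Rate

/-! ### Conclusions for the random regular graph and for the size-Ramsey number. -/

section RandomRegularGraph

instance {V : Type*} [Countable V] : MeasurableSingletonClass (SimpleGraph V) where
  measurableSet_singleton G := by
    have h := SimpleGraph.measurable_edgeSet (V := V) (measurableSet_singleton G.edgeSet)
    convert h
    ext H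
    simp

theorem mem_regularGraphs_iff {N d : ℕ} (G : SimpleGraph (Fin N)) :
    G ∈ regularGraphs N d ↔ ∀ v, (G.neighborSet v).ncard = d := by
  simp only [regularGraphs, SimpleGraph.IsRegularOfDegree]
  refine forall_congr' fun v => ?_
  rw [SimpleGraph.degree, SimpleGraph.neighborFinset, ← Set.ncard_eq_toFinset_card']

theorem coe_regularFinset (N d : ℕ) :
    (regularFinset (Fin N) d : Set (SimpleGraph (Fin N))) = regularGraphs N d := by
  ext G
  rw [mem_regularGraphs_iff, Finset.mem_coe, mem_regularFinset]

theorem not_arrows_mem_badFinset {N n s d : ℕ} (hN : 2 * s + 2 * n = N) {G : SimpleGraph (Fin N)}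
    (hreg : G ∈ regularFinset (Fin N) d) (hG : ¬Arrows G (SimpleGraph.pathGraph n) 2) :
    G ∈ badFinset (Fin N) d s (2 * n) := by
  obtain ⟨x, y, hxy, t, ht, h⟩ := exists_typing_of_not_arrows G
    (by rw [Fintype.card_fin, ← hN]; exact ⟨s + n, by ring⟩)
    (by rw [Fintype.card_fin]; omega) hG
  rw [Fintype.card_fin] at hxy
  exact mem_badFinset.2 ⟨mem_regularFinset.1 hreg, t, mem_typings.2 ⟨x, y, by omega, ht⟩, h⟩

theorem randomRegularGraph_arrows_bounds {N n s d : ℕ} (hN : 2 * s + 2 * n = N)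
    (hreg : 0 < (regularFinset (Fin N) d).card) :
    1 - ENNReal.ofReal ((badFinset (Fin N) d s (2 * n)).card / (regularFinset (Fin N) d).card) ≤
        randomRegularGraph N d {G | Arrows G (SimpleGraph.pathGraph n) 2} ∧
      randomRegularGraph N d {G | Arrows G (SimpleGraph.pathGraph n) 2} ≤ 1 := by
  classical
  have hprob : IsProbabilityMeasure (randomRegularGraph N d) := by
    refine isProbabilityMeasure_uniformOn (Set.toFinite _) ?_
    rw [← coe_regularFinset]
    exact_mod_cast Finset.card_pos.1 hreg
  refine ⟨?_, prob_le_one⟩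
  rw [tsub_le_iff_right, ← prob_add_prob_compl (μ := randomRegularGraph N d)
    (s := {G | Arrows G (SimpleGraph.pathGraph n) 2}) (Set.toFinite _).measurableSet]
  gcongr
  have hcompl : {G : SimpleGraph (Fin N) | Arrows G (SimpleGraph.pathGraph n) 2}ᶜ =
      ((Finset.univ.filter fun G : SimpleGraph (Fin N) =>
        ¬Arrows G (SimpleGraph.pathGraph n) 2 : Finset _) : Set (SimpleGraph (Fin N))) := by
    ext G; simp
  rw [randomRegularGraph, ← coe_regularFinset, hcompl, uniformOn_apply_finset,
    ENNReal.ofReal_div_of_pos (by exact_mod_cast hreg), ENNReal.ofReal_natCast,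
    ENNReal.ofReal_natCast]
  gcongr
  intro G hG
  rw [Finset.mem_inter, Finset.mem_filter] at hG
  exact not_arrows_mem_badFinset hN hG.1 hG.2.2

theorem sizeRamsey_le_of_arrows {W : Type*} {F : SimpleGraph W} {r N : ℕ}
    {G : SimpleGraph (Fin N)} (h : Arrows G F r) : sizeRamsey F r ≤ G.edgeSet.encard :=
  iInf_le_of_le N (iInf_le_of_le G (iInf_le_of_le h le_rfl))

theorem two_mul_encard_edgeSet {N d : ℕ} {G : SimpleGraph (Fin N)} (hG : G ∈ regularGraphs N d) :
    ∃ e : ℕ, G.edgeSet.encard = e ∧ 2 * e = N * d := by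
  classical
  have hdeg : ∀ v, G.degree v = d := by
    intro v
    rw [← (mem_regularGraphs_iff G).1 hG v, ← Nat.card_coe_set_eq, Nat.card_eq_fintype_card,
      SimpleGraph.card_neighborSet_eq_degree]
  refine ⟨G.edgeFinset.card, ?_, ?_⟩
  · rw [← SimpleGraph.coe_edgeFinset, Set.encard_coe_eq_coe_finsetCard]
  · rw [← G.sum_degrees_eq_twice_card_edges]
    simp [hdeg]

theorem tendsto_randomRegularGraph_arrows_path {N : ℕ → ℕ} (heven : ∀ n, Even (N n))
    (hN : ∀ n, |(N n : ℝ) - 5.4806 * (n : ℝ)| < 2) :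
    Tendsto (fun n : ℕ => randomRegularGraph (N n) 27
      {G | Arrows G (SimpleGraph.pathGraph n) 2}) atTop (𝓝 1) := by
  choose k hk using heven
  have hNn : ∀ n : ℕ, 2 ≤ n → 2 * n < N n := by
    intro n hn
    have h1 := (abs_lt.1 (hN n)).1
    have h2 : (2 : ℝ) ≤ n := by exact_mod_cast hn
    have h3 : (2 * n : ℝ) < N n := by linarith
    exact_mod_cast h3
  have hsplit : ∀ n : ℕ, 2 ≤ n → 2 * (k n - n) + 2 * n = N n := by
    intro n hn
    have := hNn n hn
    have := hk n
    omega
  have hratio : Tendsto (fun n : ℕ => (N n : ℝ) / n) atTop (𝓝 5.4806) := by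
    rw [tendsto_iff_norm_sub_tendsto_zero]
    refine squeeze_zero' (Eventually.of_forall fun n => norm_nonneg _) ?_
      (tendsto_const_div_atTop_nhds_zero_nat (2 : ℝ))
    filter_upwards [eventually_gt_atTop 0] with n hn
    have hn' : (0 : ℝ) < n := by exact_mod_cast hn
    have e : (N n : ℝ) / n - 5.4806 = (N n - 5.4806 * n) / n := by field_simp
    rw [e, Real.norm_eq_abs, abs_div, abs_of_pos hn']
    gcongr
    exact (hN n).le
  -- The `2n` vertices outside the pairs have limiting density `2/5.4806 = 10000/27403`.
  have hρ : Tendsto (fun n : ℕ => ((2 * n : ℕ) : ℝ) / N n) atTop (𝓝 (10000 / 27403)) := by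
    have h := (hratio.inv₀ (by norm_num)).const_mul 2
    rw [show (2 : ℝ) * (5.4806)⁻¹ = 10000 / 27403 by norm_num] at h
    refine h.congr fun n => ?_
    rw [inv_div]
    push_cast
    ring
  obtain ⟨hreg, hbad⟩ := tendsto_card_badFinset_div (d := 27) (by norm_num)
    (u := 65 / 54) (ρ := 10000 / 27403) (by norm_num) (by norm_num) (by norm_num)
    (by exact_mod_cast firstMomentRate_neg) (N := N) (s := fun n => k n - n)
    (r := fun n => 2 * n) (fun n => Even.mul_right ⟨k n, hk n⟩ _)
    ((eventually_ge_atTop 2).mono hsplit)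
    ((eventually_ge_atTop 2).mono fun n hn => by
      have := hNn n hn
      have := hk n
      omega)
    ((eventually_gt_atTop 0).mono fun n hn => by omega)
    (tendsto_atTop_mono' _ ((eventually_ge_atTop 2).mono fun n hn => by
      have := hNn n hn
      show n ≤ N n
      omega) tendsto_id) hρ
  have hlow := ENNReal.Tendsto.sub (tendsto_const_nhds (x := (1 : ENNReal)) (f := atTop))
    (ENNReal.tendsto_ofReal hbad) (Or.inl ENNReal.one_ne_top)
  rw [ENNReal.ofReal_zero, tsub_zero] at hlow
  have hb : ∀ᶠ n in atTop, _ := (hreg.and (eventually_ge_atTop 2)).mono fun n hn =>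
    randomRegularGraph_arrows_bounds (hsplit n hn.2) hn.1
  exact tendsto_of_tendsto_of_tendsto_of_le_of_le' hlow tendsto_const_nhds
    (hb.mono fun n hn => hn.1) (hb.mono fun n hn => hn.2)

theorem eventually_sizeRamsey_path_lt :
    ∀ᶠ n : ℕ in atTop, sizeRamsey (SimpleGraph.pathGraph n) 2 < 74 * (n : ℕ∞) := by
  -- The value `5.4806 n` rounded down to an even integer, so that the edge count stays below `27 ·
  -- 5.4806 n / 2`.
  let N : ℕ → ℕ := fun n => 2 * ⌊(2.7403 : ℝ) * n⌋₊
  have hfl : ∀ n : ℕ, (N n : ℝ) ≤ (5.4806 : ℝ) * n ∧ (5.4806 : ℝ) * n < N n + 2 := by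
    intro n
    have h1 := Nat.floor_le (a := (2.7403 : ℝ) * n) (by positivity)
    have h2 := Nat.lt_floor_add_one ((2.7403 : ℝ) * n)
    simp only [N]
    push_cast
    constructor <;> linarith
  have hN : ∀ n, |(N n : ℝ) - 5.4806 * (n : ℝ)| < 2 := by
    intro n
    rw [abs_lt]
    constructor <;> linarith [(hfl n).1, (hfl n).2]
  have ht := tendsto_randomRegularGraph_arrows_path (N := N) (fun n => even_two_mul _) hN
  have hpos := ht.eventually_const_lt (u := 0) one_pos
  filter_upwards [hpos, eventually_gt_atTop 0] with n hn hn0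
  -- Positive probability already yields a regular graph with the arrow property.
  obtain ⟨G, hGreg, hG⟩ : (regularGraphs (N n) 27 ∩
      {G | Arrows G (SimpleGraph.pathGraph n) 2}).Nonempty := by
    by_contra h
    rw [Set.not_nonempty_iff_eq_empty] at h
    rw [randomRegularGraph, ← uniformOn_inter_self (Set.toFinite _), h] at hn
    simp at hn
  refine (sizeRamsey_le_of_arrows hG).trans_lt ?_
  obtain ⟨e, he, he2⟩ := two_mul_encard_edgeSet hGreg
  rw [he]
  have h1 : (2 * e : ℝ) = N n * 27 := by exact_mod_cast he2
  have h2 : (0 : ℝ) < n := by exact_mod_cast hn0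
  -- Uses `27 · 5.4806 / 2 = 73.9881 < 74`.
  have h3 : (e : ℝ) < 74 * n := by linarith [(hfl n).1]
  have h4 : e < 74 * n := by exact_mod_cast h3
  exact_mod_cast h4

end RandomRegularGraph

/-- The number `N n` of vertices is any rounding, up or down, of `5.4806 * n` to an even integer
(it has to be even because the degree `27` is odd). -/
theorem theorem3p6 :
    (∀ N : ℕ → ℕ, (∀ n, Even (N n)) → (∀ n, |(N n : ℝ) - 5.4806 * (n : ℝ)| < 2) →
      Tendsto
        (fun n : ℕ => randomRegularGraph (N n) 27
          {G | Arrows G (SimpleGraph.pathGraph n) 2})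
        atTop (𝓝 1)) ∧
    ∀ᶠ n : ℕ in atTop, sizeRamsey (SimpleGraph.pathGraph n) 2 < 74 * (n : ℕ∞) :=
  ⟨fun _ heven hN => tendsto_randomRegularGraph_arrows_path heven hN,
    eventually_sizeRamsey_path_lt⟩
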